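/- Let $(X,\rho)$ be a metric space of finite diameter with a distinguished base point $e \in X$, and let $\mathrm{Lip}_0(X)$ be the space of all Lipschitz functions $f : X \to \mathbb{R}$ with $f(e) = 0$, normed by the Lipschitz number $L(f) = \sup_{p \neq q} |f(p)-f(q)|/\rho(p,q)$ (with $\sup\emptyset = 0$). Then $\mathrm{Lip}_0(X)$ has a strongly unique predual. That is, there is a real Banach space $V$ such that $\mathrm{Lip}_0(X)$ is isometrically isomorphic to the dual space $V^*$ and such that, for every real Banach space $W$, every (linear, surjective) isometric isomorphism $V^* \to W^*$ is continuous with respect to the weak* topologies of $V^*$ and $W^*$. -/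

import Mathlib

universe u v

namespace UniquePredual

/-- The Lipschitz number `L(f) = sup_{p ≠ q} |f p - f q| / dist p q` of a function `f : X → ℝ`
(for a Lipschitz function; diagonal pairs contribute `0 / 0 = 0`). -/
noncomputable def lipNumber {X : Type u} [MetricSpace X] (f : X → ℝ) : ℝ :=
  ⨆ pq : X × X, |f pq.1 - f pq.2| / dist pq.1 pq.2

/-- The vector space of all (possibly unbounded) Lipschitz functions `X → ℝ` that vanish at the
base point `e`. -/
def lipZeroSubmodule (X : Type u) [MetricSpace X] (e : X) : Submodule ℝ (X → ℝ) where
  carrier := {f | (∃ K : NNReal, LipschitzWith K f) ∧ f e = 0}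
  zero_mem' := ⟨⟨0, LipschitzWith.const' (0 : ℝ)⟩, rfl⟩
  add_mem' := by
    rintro f g ⟨⟨K, hf⟩, hfe⟩ ⟨⟨M, hg⟩, hge⟩
    exact ⟨⟨K + M, hf.add hg⟩, by simp [hfe, hge]⟩
  smul_mem' := by
    rintro c f ⟨⟨K, hf⟩, hfe⟩
    exact ⟨⟨‖c‖₊ * K, (lipschitzWith_smul c).comp hf⟩, by simp [hfe]⟩

/-- The space `Lip₀(X)` of a metric space `X` with base point `e`. It is a type of its own, so
that its norm is the Lipschitz number and nothing is inherited from the product topology. -/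
def LipZero (X : Type u) [MetricSpace X] (e : X) : Type u := lipZeroSubmodule X e

namespace LipZero

variable {X : Type u} [MetricSpace X] {e : X}

instance : AddCommGroup (LipZero X e) :=
  inferInstanceAs (AddCommGroup (lipZeroSubmodule X e))

instance : Module ℝ (LipZero X e) :=
  inferInstanceAs (Module ℝ (lipZeroSubmodule X e))

instance : FunLike (LipZero X e) X ℝ where
  coe f := f.1
  coe_injective := Subtype.val_injective

@[simp] theorem add_apply (f g : LipZero X e) (p : X) : (f + g) p = f p + g p := rfl

@[simp] theorem smul_apply (c : ℝ) (f : LipZero X e) (p : X) : (c • f) p = c * f p := rfl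

@[simp] theorem zero_apply (p : X) : (0 : LipZero X e) p = 0 := rfl

@[simp] theorem apply_base (f : LipZero X e) : f e = 0 := f.2.2

theorem bddAbove (f : LipZero X e) :
    BddAbove (Set.range fun pq : X × X => |f pq.1 - f pq.2| / dist pq.1 pq.2) := by
  obtain ⟨K, hK⟩ := f.2.1
  refine ⟨K, ?_⟩
  rintro _ ⟨pq, rfl⟩
  refine div_le_of_le_mul₀ dist_nonneg K.2 ?_
  have h := hK.dist_le_mul pq.1 pq.2
  rwa [Real.dist_eq] at h

/-- The norm of `Lip₀(X)` is the Lipschitz number. -/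
noncomputable instance : Norm (LipZero X e) := ⟨fun f => lipNumber f⟩

theorem norm_def (f : LipZero X e) : ‖f‖ = lipNumber f := rfl

theorem abs_sub_le (f : LipZero X e) (p q : X) : |f p - f q| ≤ ‖f‖ * dist p q := by
  rcases eq_or_ne p q with rfl | h
  · simp
  · exact (div_le_iff₀ (dist_pos.2 h)).1 (le_ciSup f.bddAbove (p, q))

theorem norm_le {f : LipZero X e} {C : ℝ} (hC : 0 ≤ C)
    (h : ∀ p q, |f p - f q| ≤ C * dist p q) : ‖f‖ ≤ C := by
  have : Nonempty (X × X) := ⟨(e, e)⟩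
  exact ciSup_le fun pq => div_le_of_le_mul₀ dist_nonneg hC (h pq.1 pq.2)

theorem norm_nonneg' (f : LipZero X e) : 0 ≤ ‖f‖ :=
  Real.iSup_nonneg fun _ => div_nonneg (abs_nonneg _) dist_nonneg

theorem core : NormedSpace.Core ℝ (LipZero X e) where
  norm_nonneg := norm_nonneg'
  norm_smul c f := by
    change lipNumber _ = |c| * lipNumber _
    rw [lipNumber, lipNumber, Real.mul_iSup_of_nonneg (abs_nonneg c)]
    congr 1
    ext pq
    rw [smul_apply, smul_apply, ← mul_sub, abs_mul, mul_div_assoc]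
  norm_triangle f g := by
    refine norm_le (add_nonneg (norm_nonneg' f) (norm_nonneg' g)) fun p q => ?_
    have h1 := abs_sub_le f p q
    have h2 := abs_sub_le g p q
    have h3 := abs_add_le (f p - f q) (g p - g q)
    have h4 : (f + g) p - (f + g) q = (f p - f q) + (g p - g q) := by
      rw [add_apply, add_apply]; ring
    rw [h4, add_mul]
    linarith
  norm_eq_zero_iff f := by
    constructor
    · intro h
      refine DFunLike.ext _ _ fun p => ?_
      have h1 := abs_sub_le f p e
      rw [h, zero_mul, apply_base, sub_zero] at h1
      exact abs_nonpos_iff.1 h1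
    · rintro rfl
      exact le_antisymm (norm_le le_rfl fun p q => by simp) (norm_nonneg' _)

noncomputable instance : NormedAddCommGroup (LipZero X e) := NormedAddCommGroup.ofCore core

noncomputable instance : NormedSpace ℝ (LipZero X e) := NormedSpace.ofCore core

end LipZero

/-- A real normed space `E` has a strongly unique predual: it is isometrically isomorphic to the
dual `V*` of a Banach space `V`, and every isometric isomorphism between `V*` and the dual `W*` of
a Banach space `W` is weak* continuous. -/
def HasStronglyUniquePredual (E : Type u) [NormedAddCommGroup E] [NormedSpace ℝ E] : Prop :=
  ∃ (V : Type u) (_ : NormedAddCommGroup V) (_ : NormedSpace ℝ V) (_ : CompleteSpace V),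
    Nonempty (E ≃ₗᵢ[ℝ] StrongDual ℝ V) ∧
    ∀ (W : Type v) [NormedAddCommGroup W] [NormedSpace ℝ W] [CompleteSpace W]
      (T : StrongDual ℝ V ≃ₗᵢ[ℝ] StrongDual ℝ W),
      Continuous fun x : WeakDual ℝ V =>
        StrongDual.toWeakDual (T (WeakDual.toStrongDual x))

end UniquePredual

/-! The predual is the closed span of the point evaluations. For uniqueness, a second predual
transported to `LipZero X e` becomes a set `𝒲` of functionals that separates points and, by
Banach–Alaoglu, makes closed balls compact (`isDualizing_range`). It suffices that `𝒲` lies in the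
span of the evaluations (`IsDualizing.mem_evalSpan`), and this reduces to showing that a bounded,
pointwise null family `f i` has only `0` as a `𝒲`-limit (`apply_eq_apply_of_pointwise_null`).

Fix points `p`, `q` and let `d` be such a limit. A function attaining its maximal slope at `(p, q)`,
and strictly flatter away from the metric segment from `p` to `q`, leaves room for a perturbation
there without increasing the norm; hence what happens there cannot affect `d p - d q`
(`null_of_le_dist_add_dist`). Using this through intermediate points as well, only a set `F`
(`visible`) matters, on which distance to `p` is an isometry into an interval; completeness makes
every non-null set accumulate at `F`.

On the totally bounded set `F` the family tends to `0` uniformly, so `f i` is a small function of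
the distance to `p` plus some `g i` vanishing on `F`. The first term is weakly null because `φ ∈ 𝒲`
acts on radial functions through an integrable density (`exists_radial_density`,
`tendsto_comp_dist`). The second is cut into dyadic annuli around `F`: each annulus is null, and a
gliding hump (`exists_trunc_small`) permits summing the pieces. Both arguments rest on
`LipZero.hasSum_of_unconditional`: weakly unconditionally Cauchy series have the same sum pointwise
and in the `𝒲`-topology. -/

open Filter Topology

namespace UniquePredual

/-! ### Dualizing families of functionals -/

/-- A family of functionals on a normed space which separates points and for whose weak topology
the closed balls are compact. -/
structure IsDualizing {E : Type*} [NormedAddCommGroup E] [NormedSpace ℝ E]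
    (𝒲 : Set (StrongDual ℝ E)) : Prop where
  eq_zero : ∀ d : E, (∀ φ ∈ 𝒲, φ d = 0) → d = 0
  exists_lim : ∀ (C : ℝ) (𝒢 : Ultrafilter E), (∀ᶠ f in (𝒢 : Filter E), ‖f‖ ≤ C) →
    ∃ d : E, ‖d‖ ≤ C ∧ ∀ φ ∈ 𝒲, Tendsto φ 𝒢 (𝓝 (φ d))

namespace IsDualizing

variable {E : Type*} [NormedAddCommGroup E] [NormedSpace ℝ E] {𝒲 : Set (StrongDual ℝ E)}

theorem ext (h𝒲 : IsDualizing 𝒲) {a b : E} (h : ∀ φ ∈ 𝒲, φ a = φ b) : a = b :=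
  sub_eq_zero.1 (h𝒲.eq_zero _ fun φ hφ => by rw [map_sub, h φ hφ, sub_self])

theorem exists_tendsto (h𝒲 : IsDualizing 𝒲) {ι : Type*} (𝒰 : Ultrafilter ι) {z : ι → E} {C : ℝ}
    (hz : ∀ᶠ i in (𝒰 : Filter ι), ‖z i‖ ≤ C) :
    ∃ d : E, ‖d‖ ≤ C ∧ ∀ φ ∈ 𝒲, Tendsto (fun i => φ (z i)) 𝒰 (𝓝 (φ d)) := by
  obtain ⟨d, hd, h⟩ := h𝒲.exists_lim C (𝒰.map z) (by simpa using hz)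
  exact ⟨d, hd, fun φ hφ => (h φ hφ).comp (by exact tendsto_map)⟩

/-- Compactness gives a limit inside the ball along a finer ultrafilter, and separation of points
identifies it with `d`. -/
theorem norm_le_of_tendsto (h𝒲 : IsDualizing 𝒲) {ι : Type*} {l : Filter ι} [l.NeBot]
    {z : ι → E} {C : ℝ} {d : E} (hz : ∀ᶠ i in l, ‖z i‖ ≤ C)
    (h : ∀ φ ∈ 𝒲, Tendsto (fun i => φ (z i)) l (𝓝 (φ d))) : ‖d‖ ≤ C := by
  obtain ⟨d', hd', h'⟩ := h𝒲.exists_tendsto (Ultrafilter.of l) (z := z) (C := C)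
    (hz.filter_mono (Ultrafilter.of_le l))
  rwa [h𝒲.ext fun φ hφ => tendsto_nhds_unique ((h φ hφ).mono_left (Ultrafilter.of_le l)) (h' φ hφ)]

end IsDualizing

/-- Taking the signs of `φ (x n)` as coefficients turns the bound on signed sums into a bound on the
sum of absolute values. -/
theorem summable_of_unconditional {E : Type*} [NormedAddCommGroup E] [NormedSpace ℝ E]
    {x : ℕ → E} {C : ℝ}
    (hx : ∀ (S : Finset ℕ) (ε : ℕ → ℝ), (∀ n, |ε n| ≤ 1) → ‖∑ n ∈ S, ε n • x n‖ ≤ C)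
    (φ : StrongDual ℝ E) : Summable fun n => φ (x n) := by
  refine Summable.of_abs (summable_of_sum_le (c := ‖φ‖ * C) (fun _ => abs_nonneg _) fun S => ?_)
  have h1 : ∑ n ∈ S, |φ (x n)| = φ (∑ n ∈ S, (SignType.sign (φ (x n)) : ℝ) • x n) := by
    rw [map_sum]
    refine Finset.sum_congr rfl fun n _ => ?_
    rw [map_smul, smul_eq_mul, sign_mul_self]
  rw [h1]
  refine (le_abs_self _).trans ((φ.le_opNorm _).trans ?_)
  refine mul_le_mul_of_nonneg_left (hx _ _ fun n => ?_) (norm_nonneg _)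
  rcases lt_trichotomy (φ (x n)) 0 with h | h | h <;> simp [h]

/-! ### Unconditionally Cauchy series of Lipschitz functions -/

namespace LipZero

variable {X : Type u} [MetricSpace X] {e : X}

@[simp] theorem sub_apply (f g : LipZero X e) (p : X) : (f - g) p = f p - g p := rfl

@[simp] theorem sum_apply {ι : Type*} (s : Finset ι) (f : ι → LipZero X e) (p : X) :
    (∑ i ∈ s, f i) p = ∑ i ∈ s, f i p := by
  classical
  induction s using Finset.induction_on with
  | empty => simp
  | insert a s ha ih => rw [Finset.sum_insert ha, Finset.sum_insert ha, add_apply, ih]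

theorem norm_le_of_tendsto {ι : Type*} {l : Filter ι} [l.NeBot] {z : ι → LipZero X e} {C : ℝ}
    {d : LipZero X e} (hC : 0 ≤ C) (hz : ∀ i, ‖z i‖ ≤ C)
    (h : ∀ p, Tendsto (fun i => z i p) l (𝓝 (d p))) : ‖d‖ ≤ C := by
  refine norm_le hC fun p q => ?_
  refine le_of_tendsto ((h p).sub (h q)).abs (Eventually.of_forall fun i => ?_)
  exact (abs_sub_le (z i) p q).trans (mul_le_mul_of_nonneg_right (hz i) dist_nonneg)

/-- Weakly unconditionally Cauchy series have the same sum pointwise and in the weak topology of a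
dualizing family. -/
theorem hasSum_of_unconditional {𝒲 : Set (StrongDual ℝ (LipZero X e))} (h𝒲 : IsDualizing 𝒲)
    {x : ℕ → LipZero X e} {C : ℝ}
    (hx : ∀ (S : Finset ℕ) (ε : ℕ → ℝ), (∀ n, |ε n| ≤ 1) → ‖∑ n ∈ S, ε n • x n‖ ≤ C)
    {v : LipZero X e}
    (hv : ∀ p, Tendsto (fun N => ∑ n ∈ Finset.range N, x n p) atTop (𝓝 (v p)))
    {φ : StrongDual ℝ (LipZero X e)} (hφ : φ ∈ 𝒲) : HasSum (fun n => φ (x n)) (φ v) := by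
  have hC : 0 ≤ C := by simpa using hx ∅ 0 (by simp)
  have hsum : ∀ φ : StrongDual ℝ (LipZero X e), Summable fun n => φ (x n) :=
    fun φ => summable_of_unconditional hx φ
  have hpart : ∀ N, ‖∑ n ∈ Finset.range N, x n‖ ≤ C := fun N => by
    simpa using hx (Finset.range N) 1 (by simp)
  obtain ⟨w, -, hw⟩ := h𝒲.exists_tendsto (hyperfilter ℕ) (Eventually.of_forall hpart)
  have hw' : ∀ φ ∈ 𝒲, Tendsto (fun N => φ (∑ n ∈ Finset.range N, x n)) atTop (𝓝 (φ w)) := by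
    intro φ hφ
    have h1 : Tendsto (fun N => φ (∑ n ∈ Finset.range N, x n)) atTop (𝓝 (∑' n, φ (x n))) := by
      simpa only [map_sum] using (hsum φ).hasSum.tendsto_sum_nat
    rwa [tendsto_nhds_unique (hw φ hφ) (h1.mono_left Nat.hyperfilter_le_atTop)]
  -- If the weak sum `w` and the pointwise sum `v` differed, taking a pointwise limit and then a
  -- weak one would produce a copy of `w - v` at no cost in norm. Repeating this `k` times bounds `k
  -- • (w - v)` independently of `k`.
  have key : ∀ (k : ℕ) (S : Finset ℕ) (ε : ℕ → ℝ), (∀ n, |ε n| ≤ 1) →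
      ‖(k : ℝ) • (w - v) + ∑ n ∈ S, ε n • x n‖ ≤ C := by
    intro k
    induction k with
    | zero => intro S ε hε; simpa using hx S ε hε
    | succ k ih =>
      intro S ε hε
      set y := (k : ℝ) • (w - v) + ∑ n ∈ S, ε n • x n with hy
      obtain ⟨M, hM⟩ : ∃ M, ∀ n ∈ S, n < M := ⟨S.sup id + 1, fun n hn =>
        Nat.lt_succ_of_le (Finset.le_sup (f := id) hn)⟩
      -- The block from `N` to `N'` uses indices outside `S`, so it may be added with coefficient
      -- `-1`; the norm bound survives the pointwise limit in `N'`.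
      have htail : ∀ N, M ≤ N → ‖y - (v - ∑ n ∈ Finset.range N, x n)‖ ≤ C := by
        intro N hN
        have h1 : ∀ N', N ≤ N' →
            ‖y - (∑ n ∈ Finset.range N', x n - ∑ n ∈ Finset.range N, x n)‖ ≤ C := by
          intro N' hN'
          rw [← Finset.sum_Ico_eq_sub _ hN']
          classical
          have hdis : Disjoint S (Finset.Ico N N') := by
            rw [Finset.disjoint_left]
            intro n hn hn'
            have := hM n hn
            have := (Finset.mem_Ico.1 hn').1
            omega
          have h2 := ih (S ∪ Finset.Ico N N') (fun n => if n ∈ S then ε n else -1) (by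
            intro n
            split_ifs
            · exact hε n
            · simp)
          rw [Finset.sum_union hdis] at h2
          convert h2 using 2
          rw [hy, sub_eq_add_neg, add_assoc, ← Finset.sum_neg_distrib]
          congr 1
          congr 1
          · exact Finset.sum_congr rfl fun n hn => by rw [if_pos hn]
          · refine Finset.sum_congr rfl fun n hn => ?_
            rw [if_neg (Finset.disjoint_right.1 hdis hn), neg_one_smul]
        refine norm_le_of_tendsto (l := atTop) (z := fun N' => y -
            (∑ n ∈ Finset.range (max N N'), x n - ∑ n ∈ Finset.range N, x n)) hC
          (fun N' => h1 _ (le_max_left _ _)) fun p => ?_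
        have h3 : Tendsto (fun N' => max N N') atTop atTop :=
          tendsto_atTop_mono (fun N' => le_max_right N N') tendsto_id
        have h4 := ((hv p).comp h3).sub_const (∑ n ∈ Finset.range N, x n p) |>.const_sub (y p)
        simpa [Function.comp_def] using h4
      -- Now `N` tends to infinity in the `𝒲`-topology, where the partial sums tend to `w` instead
      -- of `v`.
      have hlim : ‖y + (w - v)‖ ≤ C := by
        refine h𝒲.norm_le_of_tendsto (l := atTop)
          (z := fun N => y - (v - ∑ n ∈ Finset.range N, x n))
          (eventually_atTop.2 ⟨M, htail⟩) fun φ hφ => ?_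
        have h5 := ((hw' φ hφ).const_sub (φ v)).const_sub (φ y)
        simp only [map_sub, map_add] at h5 ⊢
        convert h5 using 2
        ring
      convert hlim using 2
      rw [hy]
      push_cast
      module
  have hwv : w = v := by
    rw [← sub_eq_zero, ← norm_eq_zero]
    refine le_antisymm (le_of_not_gt fun hpos => ?_) (norm_nonneg _)
    obtain ⟨k, hk⟩ := exists_nat_gt (C / ‖w - v‖)
    have h6 := key k ∅ 0 (by simp)
    rw [Finset.sum_empty, add_zero, norm_smul, Real.norm_natCast] at h6
    rw [div_lt_iff₀ hpos] at hk
    linarith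
  rw [← hwv, (hsum φ).hasSum_iff_tendsto_nat]
  simpa only [map_sum] using hw' φ hφ

/-- Evaluation at a point, as a continuous linear functional. -/
noncomputable def eval (e p : X) : StrongDual ℝ (LipZero X e) :=
  LinearMap.mkContinuous
    { toFun := fun f => f p
      map_add' := fun _ _ => rfl
      map_smul' := fun _ _ => rfl } (dist p e) fun f => by
    have := f.abs_sub_le p e
    rwa [apply_base, sub_zero, mul_comm] at this

@[simp] theorem eval_apply (p : X) (f : LipZero X e) : eval e p f = f p := rfl

theorem exists_hasSum_of_unconditional {𝒲 : Set (StrongDual ℝ (LipZero X e))}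
    (h𝒲 : IsDualizing 𝒲) {x : ℕ → LipZero X e} {C : ℝ}
    (hx : ∀ (S : Finset ℕ) (ε : ℕ → ℝ), (∀ n, |ε n| ≤ 1) → ‖∑ n ∈ S, ε n • x n‖ ≤ C) :
    ∃ v : LipZero X e, (∀ p, HasSum (fun n => x n p) (v p)) ∧
      ∀ φ ∈ 𝒲, HasSum (fun n => φ (x n)) (φ v) := by
  have hC : 0 ≤ C := by simpa using hx ∅ 0 (by simp)
  have hs : ∀ p, Summable fun n => x n p := fun p => summable_of_unconditional hx (eval e p)
  have hlip : LipschitzWith C.toNNReal fun p => ∑' n, x n p :=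
    LipschitzWith.of_dist_le_mul fun p q => by
      rw [Real.dist_eq, Real.coe_toNNReal _ hC]
      refine le_of_tendsto (((hs p).hasSum.tendsto_sum_nat.sub
        (hs q).hasSum.tendsto_sum_nat).abs) (Eventually.of_forall fun N => ?_)
      rw [← sum_apply, ← sum_apply]
      refine (abs_sub_le _ p q).trans (mul_le_mul_of_nonneg_right ?_ dist_nonneg)
      simpa using hx (Finset.range N) 1 (by simp)
  let v : LipZero X e := ⟨fun p => ∑' n, x n p, ⟨_, hlip⟩, by simp⟩
  have hv : ∀ p, HasSum (fun n => x n p) (v p) := fun p => (hs p).hasSum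
  exact ⟨v, hv, fun φ hφ => hasSum_of_unconditional h𝒲 hx (fun p => (hv p).tendsto_sum_nat) hφ⟩

end LipZero

/-! ### Calculus of Lipschitz bounds -/

section LipBd

variable {X : Type u} [MetricSpace X] {e : X}

/-- The function `g` is Lipschitz with the (real) constant `K`. -/
def LipBd (K : ℝ) (g : X → ℝ) : Prop := ∀ x y, |g x - g y| ≤ K * dist x y

theorem LipBd.mono {K L : ℝ} {g : X → ℝ} (h : LipBd K g) (hKL : K ≤ L) : LipBd L g :=
  fun x y => (h x y).trans (mul_le_mul_of_nonneg_right hKL dist_nonneg)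

theorem LipBd.lipschitzWith {K : ℝ} {g : X → ℝ} (h : LipBd K g) : LipschitzWith K.toNNReal g :=
  LipschitzWith.of_dist_le_mul fun x y => by
    rw [Real.dist_eq]
    exact (h x y).trans (mul_le_mul_of_nonneg_right (Real.le_coe_toNNReal K) dist_nonneg)

theorem LipBd.continuous {K : ℝ} {g : X → ℝ} (h : LipBd K g) : Continuous g :=
  h.lipschitzWith.continuous

theorem LipBd.add {K L : ℝ} {f g : X → ℝ} (hf : LipBd K f) (hg : LipBd L g) :
    LipBd (K + L) (fun x => f x + g x) := fun x y => by
  have h1 := abs_add_le (f x - f y) (g x - g y)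
  have h2 := hf x y
  have h3 := hg x y
  rw [add_mul, show f x + g x - (f y + g y) = (f x - f y) + (g x - g y) by ring]
  linarith

theorem LipBd.sub {K L : ℝ} {f g : X → ℝ} (hf : LipBd K f) (hg : LipBd L g) :
    LipBd (K + L) (fun x => f x - g x) := fun x y => by
  have h1 := abs_sub (f x - f y) (g x - g y)
  have h2 := hf x y
  have h3 := hg x y
  rw [add_mul, show f x - g x - (f y - g y) = (f x - f y) - (g x - g y) by ring]
  linarith

theorem LipBd.const_mul {K : ℝ} {f : X → ℝ} (hf : LipBd K f) (c : ℝ) :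
    LipBd (|c| * K) (fun x => c * f x) := fun x y => by
  rw [← mul_sub, abs_mul, mul_assoc]
  exact mul_le_mul_of_nonneg_left (hf x y) (abs_nonneg c)

theorem LipBd.sub_const {K : ℝ} {f : X → ℝ} (hf : LipBd K f) (c : ℝ) :
    LipBd K (fun x => f x - c) := fun x y => by simpa using hf x y

theorem LipBd.mul {K L A B : ℝ} {f g : X → ℝ} (hf : LipBd K f) (hg : LipBd L g)
    (hA : ∀ x, |f x| ≤ A) (hB : ∀ x, |g x| ≤ B) : LipBd (A * L + B * K) (fun x => f x * g x) :=
  fun x y => by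
    have h1 : |f x * (g x - g y)| ≤ A * (L * dist x y) := by
      rw [abs_mul]
      exact mul_le_mul (hA x) (hg x y) (abs_nonneg _) ((abs_nonneg _).trans (hA x))
    have h2 : |g y * (f x - f y)| ≤ B * (K * dist x y) := by
      rw [abs_mul]
      exact mul_le_mul (hB y) (hf x y) (abs_nonneg _) ((abs_nonneg _).trans (hB y))
    have h3 := abs_add_le (f x * (g x - g y)) (g y * (f x - f y))
    rw [show f x * g x - f y * g y = f x * (g x - g y) + g y * (f x - f y) by ring]
    linarith

theorem LipBd.max {K : ℝ} {f g : X → ℝ} (hf : LipBd K f) (hg : LipBd K g) :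
    LipBd K (fun x => max (f x) (g x)) := fun x y =>
  (abs_max_sub_max_le_max _ _ _ _).trans (max_le (hf x y) (hg x y))

theorem LipBd.min {K : ℝ} {f g : X → ℝ} (hf : LipBd K f) (hg : LipBd K g) :
    LipBd K (fun x => min (f x) (g x)) := fun x y =>
  (abs_min_sub_min_le_max _ _ _ _).trans (max_le (hf x y) (hg x y))

theorem lipBd_const {K : ℝ} (hK : 0 ≤ K) (c : ℝ) : LipBd K (fun _ : X => c) := fun x y => by
  simpa using mul_nonneg hK dist_nonneg

theorem lipBd_dist (p : X) : LipBd 1 (fun x => dist x p) := fun x y => by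
  rw [one_mul]; exact abs_dist_sub_le x y p

theorem LipZero.lipBd (f : LipZero X e) : LipBd ‖f‖ f := f.abs_sub_le

theorem LipBd.nonneg_of_ne {K : ℝ} {f : X → ℝ} (hf : LipBd K f) {p q : X} (h : p ≠ q) : 0 ≤ K :=
  nonneg_of_mul_nonneg_left ((abs_nonneg _).trans (hf p q)) (dist_pos.2 h)

/-- The element `x ↦ g x - g e` of `LipZero X e` if `g` is Lipschitz, and `0` otherwise. -/
noncomputable def LipZero.ofFun (e : X) (g : X → ℝ) : LipZero X e :=
  open Classical in
  if h : ∃ K : NNReal, LipschitzWith K (fun x => g x - g e) then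
    ⟨fun x => g x - g e, h, sub_self _⟩ else 0

open LipZero

theorem LipBd.ofFun_apply {K : ℝ} {g : X → ℝ} (h : LipBd K g) (x : X) :
    ofFun e g x = g x - g e := by
  have h' : ∃ K : NNReal, LipschitzWith K (fun x => g x - g e) :=
    ⟨_, (h.sub_const (g e)).lipschitzWith⟩
  have h'' : ofFun e g = ⟨fun x => g x - g e, h', sub_self _⟩ := dif_pos h'
  rw [h'']
  rfl

theorem LipBd.norm_ofFun_le {K : ℝ} {g : X → ℝ} (h : LipBd K g) (hK : 0 ≤ K) :
    ‖ofFun e g‖ ≤ K :=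
  norm_le hK fun p q => by
    rw [h.ofFun_apply, h.ofFun_apply, sub_sub_sub_cancel_right]
    exact h p q

theorem LipBd.ofFun_sub {K L : ℝ} {f g : X → ℝ} (hf : LipBd K f) (hg : LipBd L g) :
    ofFun e (fun x => f x - g x) = ofFun e f - ofFun e g := by
  refine DFunLike.ext _ _ fun x => ?_
  rw [LipZero.sub_apply, hf.ofFun_apply, hg.ofFun_apply, (hf.sub hg).ofFun_apply]
  ring

theorem LipZero.ofFun_coe (f : LipZero X e) : ofFun e f = f :=
  DFunLike.ext _ _ fun x => by rw [f.lipBd.ofFun_apply, apply_base, sub_zero]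

end LipBd

/-! ### Null sets and visible points -/

section Null

variable {X : Type u} [MetricSpace X] {e : X} {ι : Type*}

/-- Bounded families of functions that are constant off `A` cannot have a weak limit (along `𝒰`)
which separates `p` from `q`. -/
def Null (𝒲 : Set (StrongDual ℝ (LipZero X e))) (𝒰 : Ultrafilter ι) (p q : X) (A : Set X) : Prop :=
  ∀ (g : ι → LipZero X e) (C : ℝ) (d : LipZero X e), (∀ i, ‖g i‖ ≤ C) →
    (∀ i, ∃ c, ∀ x, x ∉ A → g i x = c) →
    (∀ φ ∈ 𝒲, Tendsto (fun i => φ (g i)) 𝒰 (𝓝 (φ d))) → d p = d q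

variable {𝒲 : Set (StrongDual ℝ (LipZero X e))} {𝒰 : Ultrafilter ι} {p q : X} {A B : Set X}

theorem Null.mono (h : Null 𝒲 𝒰 p q B) (hAB : A ⊆ B) : Null 𝒲 𝒰 p q A :=
  fun g C d hg hc hd => h g C d hg
    (fun i => (hc i).imp fun _ hc x hx => hc x fun hx' => hx (hAB hx')) hd

theorem Null.trans {w : X} (h1 : Null 𝒲 𝒰 p w A) (h2 : Null 𝒲 𝒰 w q A) : Null 𝒲 𝒰 p q A :=
  fun g C d hg hc hd => (h1 g C d hg hc hd).trans (h2 g C d hg hc hd)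

theorem null_empty (h𝒲 : IsDualizing 𝒲) : Null 𝒲 𝒰 p q ∅ := by
  intro g C d hg hc hd
  have hg0 : ∀ i, g i = 0 := fun i => by
    obtain ⟨c, hc⟩ := hc i
    refine DFunLike.ext _ _ fun x => ?_
    rw [hc x (Set.notMem_empty x), ← hc e (Set.notMem_empty e), LipZero.apply_base,
      LipZero.zero_apply]
  have : d = 0 := h𝒲.eq_zero d fun φ hφ => by
    have := hd φ hφ
    simp only [hg0, map_zero] at this
    exact (tendsto_nhds_unique this tendsto_const_nhds)
  rw [this, LipZero.zero_apply, LipZero.zero_apply]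

/-- Functions living where `dist x p + dist x q` exceeds `dist p q` are invisible to `p`, `q`. -/
theorem null_of_le_dist_add_dist (h𝒲 : IsDualizing 𝒲) {η : ℝ} (hη : 0 < η) :
    Null 𝒲 𝒰 p q {x | dist p q + η ≤ dist x p + dist x q} := by
  intro g C₀ d hg₀ hc hd
  rcases eq_or_ne p q with rfl | hpq
  · rfl
  obtain ⟨C, hC, hg⟩ : ∃ C, 0 < C ∧ ∀ i, ‖g i‖ ≤ C :=
    ⟨max C₀ 1, by positivity, fun i => (hg₀ i).trans (le_max_left _ _)⟩
  set r := dist p q with hr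
  have hr0 : 0 < r := dist_pos.2 hpq
  set σ : X → ℝ := fun x => dist x p + dist x q with hσ
  have hσr : ∀ x, r ≤ σ x := fun x => by
    simpa [hσ, hr, dist_comm] using dist_triangle p x q
  have hσ0 : ∀ x, 0 < σ x := fun x => hr0.trans_le (hσr x)
  -- `y` runs from `r / 2` at `p` to `-r / 2` at `q`, and its slope between `a` and `b` is at most
  -- `r / σ b`: at most `1` everywhere, and strictly less once an endpoint lies in the given set.
  set y : X → ℝ := fun x => r * (1 / 2 - dist x p / σ x) with hy
  have key : ∀ a b, |y a - y b| ≤ r / σ b * dist a b := by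
    intro a b
    have h1 : y a - y b = r / σ b *
        ((dist a p * (dist b q - dist a q) + dist a q * (dist a p - dist b p)) / σ a) * (-1) := by
      have := (hσ0 a).ne'
      have := (hσ0 b).ne'
      simp only [hy]
      field_simp
      simp only [hσ]
      ring
    rw [h1, abs_mul, abs_neg, abs_one, mul_one, abs_mul, abs_of_pos (div_pos hr0 (hσ0 b))]
    refine mul_le_mul_of_nonneg_left ?_ (div_pos hr0 (hσ0 b)).le
    rw [abs_div, abs_of_pos (hσ0 a), div_le_iff₀ (hσ0 a)]
    refine (abs_add_le _ _).trans ?_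
    rw [abs_mul, abs_mul, abs_of_nonneg dist_nonneg, abs_of_nonneg dist_nonneg]
    have h2 : |dist b q - dist a q| ≤ dist a b := by
      rw [dist_comm a b]; exact abs_dist_sub_le b a q
    have h3 : |dist a p - dist b p| ≤ dist a b := abs_dist_sub_le a b p
    have h4 := mul_le_mul_of_nonneg_left h2 (dist_nonneg (x := a) (y := p))
    have h5 := mul_le_mul_of_nonneg_left h3 (dist_nonneg (x := a) (y := q))
    simp only [hσ]
    nlinarith
  have hybd : LipBd 1 y := fun a b => (key a b).trans
    (mul_le_mul_of_nonneg_right ((div_le_one (hσ0 b)).2 (hσr b)) dist_nonneg)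
  have hyp : y p - y q = r := by
    have : σ q = r := by simp [hσ, hr, dist_comm]
    simp only [hy, dist_self, this, zero_div, dist_comm q p, ← hr, div_self hr0.ne']
    ring
  have hfar : ∀ a b, r + η ≤ σ b → |y a - y b| ≤ r / (r + η) * dist a b := fun a b hb =>
    (key a b).trans (mul_le_mul_of_nonneg_right
      (div_le_div_of_nonneg_left hr0.le (by positivity) hb) dist_nonneg)
  -- The largest `t` for which a perturbation of slope `t * C` fits into the gap between `r / (r +
  -- η)` and `1`.
  set t := η / (C * (r + η)) with ht
  have ht0 : 0 < t := by positivity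
  have htC : r / (r + η) + t * C = 1 := by
    rw [ht]
    have : r + η ≠ 0 := by positivity
    field_simp
  -- Both signs are needed: `y` already has slope `1` at `(p, q)`, so neither `y + t • d` nor `y - t
  -- • d` can stay in the unit ball unless `d p = d q`.
  have hbd : ∀ (s : ℝ), |s| = 1 → |(y p - y q) + s * t * (d p - d q)| ≤ 1 * r := by
    intro s hs
    have hz : ∀ i, ‖LipZero.ofFun e y + (s * t) • g i‖ ≤ 1 := by
      intro i
      refine LipZero.norm_le zero_le_one fun a b => ?_
      rw [LipZero.add_apply, LipZero.add_apply, LipZero.smul_apply, LipZero.smul_apply,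
        hybd.ofFun_apply, hybd.ofFun_apply,
        show y a - y e + s * t * g i a - (y b - y e + s * t * g i b) =
          (y a - y b) + s * t * (g i a - g i b) by ring]
      have h1 : |s * t * (g i a - g i b)| ≤ t * C * dist a b := by
        rw [abs_mul, abs_mul, hs, one_mul, abs_of_pos ht0, mul_assoc]
        exact mul_le_mul_of_nonneg_left (((g i).abs_sub_le a b).trans
          (mul_le_mul_of_nonneg_right (hg i) dist_nonneg)) ht0.le
      by_cases ha : r + η ≤ σ a
      · refine (abs_add_le _ _).trans ?_
        have h2 := hfar b a ha
        rw [abs_sub_comm, dist_comm] at h2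
        rw [← htC]
        linarith
      by_cases hb : r + η ≤ σ b
      · refine (abs_add_le _ _).trans ?_
        have h2 := hfar a b hb
        rw [← htC]
        linarith
      · obtain ⟨c, hc⟩ := hc i
        rw [hc a ha, hc b hb, sub_self, mul_zero, add_zero]
        exact hybd a b
    have hlim : ‖LipZero.ofFun e y + (s * t) • d‖ ≤ 1 := by
      refine h𝒲.norm_le_of_tendsto (l := (𝒰 : Filter ι)) (Eventually.of_forall hz)
        fun φ hφ => ?_
      simp only [map_add, map_smul]
      exact ((hd φ hφ).const_smul _).const_add _
    have h3 := (LipZero.abs_sub_le (LipZero.ofFun e y + (s * t) • d) p q).trans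
      (mul_le_mul_of_nonneg_right hlim dist_nonneg)
    rw [LipZero.add_apply, LipZero.add_apply, LipZero.smul_apply, LipZero.smul_apply,
        hybd.ofFun_apply, hybd.ofFun_apply] at h3
    rwa [show (y p - y q) + s * t * (d p - d q) =
      y p - y e + s * t * d p - (y q - y e + s * t * d q) by ring]
  have h1 := (abs_le.1 (hbd 1 (by simp))).2
  have h2 := (abs_le.1 (hbd (-1) (by simp))).2
  rw [hyp] at h1 h2
  have h3 : t * (d p - d q) = 0 := by linarith
  exact sub_eq_zero.1 ((mul_eq_zero.1 h3).resolve_left ht0.ne')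

/-- A Lipschitz cutoff in `σ` splits each function into two, one for each part of `A`. Bounded
diameter keeps the products uniformly Lipschitz, and compactness supplies a weak limit for each
half. The overlap `α < σ < β` is where the cutoff descends. -/
theorem Null.split (h𝒲 : IsDualizing 𝒲) {D : ℝ} (hD : ∀ x y : X, dist x y ≤ D) {σ : X → ℝ}
    {L : ℝ} (hσ : LipBd L σ) {α β : ℝ} (hαβ : α < β) (h1 : Null 𝒲 𝒰 p q (A ∩ {x | σ x < β}))
    (h2 : Null 𝒲 𝒰 p q (A ∩ {x | α < σ x})) : Null 𝒲 𝒰 p q A := by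
  intro g C d hg hc hd
  have hC : 0 ≤ C := by
    obtain ⟨i⟩ := Filter.nonempty_of_neBot (𝒰 : Filter ι)
    exact (norm_nonneg _).trans (hg i)
  -- When `A` is the whole space, the constant off `A` is arbitrary and need not be close to the
  -- values of `g i`; the value at `e` is used instead.
  have hc' : ∀ i, ∃ c, (∀ x, x ∉ A → g i x = c) ∧ ∀ x, |g i x - c| ≤ C * D := by
    intro i
    have hgi : ∀ x y, |g i x - g i y| ≤ C * D := fun x y => ((g i).abs_sub_le x y).trans
      (mul_le_mul (hg i) (hD x y) dist_nonneg hC)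
    by_cases hA : ∃ y, y ∉ A
    · obtain ⟨y, hy⟩ := hA
      obtain ⟨c, hc⟩ := hc i
      exact ⟨c, hc, fun x => by rw [← hc y hy]; exact hgi x y⟩
    · push Not at hA
      exact ⟨g i e, fun x hx => absurd (hA x) hx, fun x => hgi x e⟩
  choose c hc hcb using hc'
  set χ : X → ℝ := fun x => max 0 (min 1 ((β - α)⁻¹ * (β - σ x))) with hχ
  have hβα : 0 < β - α := sub_pos.2 hαβ
  have hχL : LipBd (|(β - α)⁻¹| * (0 + L)) χ := by
    have h3 : LipBd (|(β - α)⁻¹| * (0 + L)) (fun x => (β - α)⁻¹ * (β - σ x)) :=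
      ((lipBd_const le_rfl β).sub hσ).const_mul _
    rcases subsingleton_or_nontrivial X with hX | hX
    · intro x y
      rw [Subsingleton.elim x y]
      simp
    · obtain ⟨a, b, hab⟩ := exists_pair_ne X
      have hK := h3.nonneg_of_ne hab
      exact (lipBd_const hK 0).max ((lipBd_const hK 1).min h3)
  set L' := |(β - α)⁻¹| * (0 + L)
  have hχ0 : ∀ x, 0 ≤ χ x := fun x => le_max_left _ _
  have hχ1 : ∀ x, χ x ≤ 1 := fun x => max_le zero_le_one (min_le_left _ _)
  have hχz : ∀ x, β ≤ σ x → χ x = 0 := fun x hx => max_eq_left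
    ((min_le_right _ _).trans (mul_nonpos_of_nonneg_of_nonpos (inv_pos.2 hβα).le (by linarith)))
  have hχo : ∀ x, σ x ≤ α → χ x = 1 := fun x hx => by
    have : 1 ≤ (β - α)⁻¹ * (β - σ x) := by
      rw [inv_mul_eq_div, le_div_iff₀ hβα]
      linarith
    simp only [hχ, min_eq_left this, max_eq_right zero_le_one]
  have hprod : ∀ i, LipBd (C * D * L' + 1 * C) (fun x => (g i x - c i) * χ x) := fun i =>
    (((g i).lipBd.mono (hg i)).sub_const (c i)).mul hχL (hcb i) fun x => by
      rw [abs_of_nonneg (hχ0 x)]; exact hχ1 x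
  set g1 : ι → LipZero X e := fun i => LipZero.ofFun e (fun x => (g i x - c i) * χ x)
  have hg1n : ∀ i, ‖g1 i‖ ≤ max 0 (C * D * L' + 1 * C) := fun i =>
    ((hprod i).mono (le_max_right _ _)).norm_ofFun_le (le_max_left _ _)
  obtain ⟨d1, -, hd1⟩ := h𝒲.exists_tendsto 𝒰 (Eventually.of_forall hg1n)
  have e1 : d1 p = d1 q := by
    refine h1 g1 _ d1 hg1n (fun i => ⟨0 - (g i e - c i) * χ e, fun x hx => ?_⟩) hd1
    rw [(hprod i).ofFun_apply]
    congr 1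
    by_cases hxA : x ∈ A
    · rw [hχz x (not_lt.1 fun h => hx ⟨hxA, h⟩), mul_zero]
    · rw [hc i x hxA, sub_self, zero_mul]
  have e2 : (d - d1) p = (d - d1) q := by
    refine h2 (fun i => g i - g1 i) (C + max 0 (C * D * L' + 1 * C)) (d - d1)
      (fun i => (norm_sub_le _ _).trans (add_le_add (hg i) (hg1n i)))
      (fun i => ⟨c i + (g i e - c i) * χ e, fun x hx => ?_⟩) fun φ hφ => by
        simpa only [map_sub] using (hd φ hφ).sub (hd1 φ hφ)
    rw [LipZero.sub_apply, (hprod i).ofFun_apply]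
    by_cases hxA : x ∈ A
    · rw [hχo x (not_lt.1 fun h => hx ⟨hxA, h⟩)]
      ring
    · rw [hc i x hxA]
      ring
  rw [LipZero.sub_apply, LipZero.sub_apply, e1] at e2
  linarith

/-- The points all of whose neighbourhoods are visible to `p` and `q`. -/
def visible (𝒲 : Set (StrongDual ℝ (LipZero X e))) (𝒰 : Ultrafilter ι) (p q : X) : Set X :=
  {w | ∀ δ > 0, ¬ Null 𝒲 𝒰 p q (Metric.ball w δ)}

/-- Such points are off the segment from `p` to `w` and off the one from `w` to `q`, so `d p = d w =
d q`. -/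
theorem null_of_le_excess (h𝒲 : IsDualizing 𝒲) (w : X) {η : ℝ} (hη : 0 < η) :
    Null 𝒲 𝒰 p q {x | η ≤ min (dist x p + dist x w - dist p w) (dist x w + dist x q - dist w q)} :=
  Null.trans (w := w)
    ((null_of_le_dist_add_dist h𝒲 hη).mono fun x hx => by
      simp only [Set.mem_ofPred_eq, le_min_iff] at hx ⊢
      linarith [hx.1])
    ((null_of_le_dist_add_dist h𝒲 hη).mono fun x hx => by
      simp only [Set.mem_ofPred_eq, le_min_iff] at hx ⊢
      linarith [hx.2])

theorem Null.of_slices (h𝒲 : IsDualizing 𝒲) {D : ℝ} (hD : ∀ x y : X, dist x y ≤ D)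
    {ε : ℝ} (hε : 0 < ε)
    (h : ∀ j : ℕ, Null 𝒲 𝒰 p q (A ∩ {x | (j - 1) * ε < dist x p ∧ dist x p < (j + 1) * ε})) :
    Null 𝒲 𝒰 p q A := by
  have key : ∀ n : ℕ, Null 𝒲 𝒰 p q (A ∩ {x | dist x p < n * ε}) := by
    intro n
    induction n with
    | zero =>
      refine (null_empty h𝒲).mono ?_
      rintro x ⟨-, hx⟩
      simp only [Nat.cast_zero, zero_mul, Set.mem_ofPred_eq] at hx
      exact absurd hx (not_lt.2 dist_nonneg)
    | succ n ih =>
      refine Null.split h𝒲 hD (lipBd_dist p) (α := (n - 1) * ε) (β := n * ε) (by linarith)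
        (ih.mono fun x hx => ⟨hx.1.1, hx.2⟩) ((h n).mono fun x hx => ⟨hx.1.1, hx.2, ?_⟩)
      simpa using hx.1.2
  obtain ⟨n, hn⟩ := exists_nat_gt (D / ε)
  refine (key n).mono fun x hx => ⟨hx, ?_⟩
  rw [div_lt_iff₀ hε] at hn
  exact (hD x p).trans_lt hn

/-- Three cuts each keep a non-null part: a thin shell around `p`, a thin neighbourhood of the
segment from `p` to `q`, and the points of small excess relative to some `w` already in the set.
Near the segment and at almost the same distance from `p`, small excess forces closeness to `w`. -/
theorem exists_small_of_not_null (h𝒲 : IsDualizing 𝒲) {D : ℝ} (hD : ∀ x y : X, dist x y ≤ D)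
    (hA : ¬ Null 𝒲 𝒰 p q A) {ε : ℝ} (hε : 0 < ε) :
    ∃ B ⊆ A, ¬ Null 𝒲 𝒰 p q B ∧ ∃ w, ∀ x ∈ B, dist x w < 4 * ε := by
  obtain ⟨j, hj⟩ := not_forall.1 fun h => hA (Null.of_slices h𝒲 hD hε h)
  set B1 := A ∩ {x | (j - 1) * ε < dist x p ∧ dist x p < (j + 1) * ε}
  set B2 := B1 ∩ {x | dist x p + dist x q < dist p q + ε}
  have hB2 : ¬ Null 𝒲 𝒰 p q B2 := fun h => hj <| by
    refine Null.split h𝒲 hD ((lipBd_dist p).add (lipBd_dist q)) (α := dist p q + ε / 2)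
      (by linarith) h ((null_of_le_dist_add_dist h𝒲 (half_pos hε)).mono ?_)
    intro x hx
    have h' := hx.2
    simp only [Set.mem_ofPred_eq] at h' ⊢
    exact h'.le
  obtain ⟨w, hw⟩ : B2.Nonempty := Set.nonempty_iff_ne_empty.2 fun h => hB2 (h ▸ null_empty h𝒲)
  set B3 := B2 ∩ {x | min (dist x p + dist x w - dist p w) (dist x w + dist x q - dist w q) < ε}
  have hB3 : ¬ Null 𝒲 𝒰 p q B3 := fun h => hB2 <| by
    refine Null.split h𝒲 hD ((((lipBd_dist p).add (lipBd_dist w)).sub_const (dist p w)).min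
      (((lipBd_dist w).add (lipBd_dist q)).sub_const (dist w q))) (α := ε / 2) (by linarith) h
      ((null_of_le_excess h𝒲 w (half_pos hε)).mono ?_)
    intro x hx
    have h' := hx.2
    simp only [Set.mem_ofPred_eq] at h' ⊢
    exact h'.le
  refine ⟨B3, fun x hx => hx.1.1.1, hB3, w, fun x hx => ?_⟩
  obtain ⟨⟨⟨-, hx1, hx2⟩, hx3⟩, hx4⟩ := hx
  obtain ⟨⟨-, hw1, hw2⟩, hw3⟩ := hw
  simp only [Set.mem_ofPred_eq, min_lt_iff] at hx3 hx4 hw3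
  have h1 := dist_triangle_left p q x
  have h2 := dist_comm p w
  rcases hx4 with h | h <;> linarith

/-- Iterating `exists_small_of_not_null` gives nested non-null sets of vanishing diameter. The
common point of their closures, which exists by completeness, is visible since each ball around it
contains one of them. -/
theorem exists_visible_mem_closure [CompleteSpace X] (h𝒲 : IsDualizing 𝒲) {D : ℝ}
    (hD : ∀ x y : X, dist x y ≤ D) (hA : ¬ Null 𝒲 𝒰 p q A) :
    ∃ w ∈ visible 𝒲 𝒰 p q, w ∈ closure A := by
  have step : ∀ (n : ℕ) (B : {B // ¬ Null 𝒲 𝒰 p q B}), ∃ B' : {B // ¬ Null 𝒲 𝒰 p q B},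
      B'.1 ⊆ B.1 ∧ Metric.diam B'.1 ≤ 8 * (1 / ((n : ℝ) + 1)) := by
    intro n B
    have hε : 0 < 1 / ((n : ℝ) + 1) := Nat.one_div_pos_of_nat
    obtain ⟨B', hB', hn, w, hw⟩ := exists_small_of_not_null h𝒲 hD B.2 hε
    refine ⟨⟨B', hn⟩, hB', Metric.diam_le_of_forall_dist_le (by positivity) fun x hx y hy => ?_⟩
    have := dist_triangle_right x y w
    linarith [hw x hx, hw y hy]
  choose f hf1 hf2 using step
  let S : ℕ → {B // ¬ Null 𝒲 𝒰 p q B} := fun n => Nat.rec ⟨A, hA⟩ f n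
  have hS : ∀ n, (S (n + 1)).1 ⊆ (S n).1 := fun n => hf1 n _
  have hanti : Antitone fun n => (S n).1 := antitone_nat_of_succ_le hS
  have hbdd : ∀ B : Set X, Bornology.IsBounded B := fun B =>
    Metric.isBounded_iff.2 ⟨D, fun x _ y _ => hD x y⟩
  have hne : ∀ n, (S n).1.Nonempty := fun n =>
    Set.nonempty_iff_ne_empty.2 fun h => (S n).2 (h ▸ null_empty h𝒲)
  have hdiam : Tendsto (fun n => Metric.diam (closure (S n).1)) atTop (𝓝 0) := by
    rw [← tendsto_add_atTop_iff_nat 1]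
    have h8 : Tendsto (fun n : ℕ => 8 * (1 / ((n : ℝ) + 1))) atTop (𝓝 0) := by
      simpa using tendsto_one_div_add_atTop_nhds_zero_nat.const_mul (8 : ℝ)
    refine squeeze_zero (fun n => Metric.diam_nonneg) (fun n => ?_) h8
    rw [Metric.diam_closure]
    exact hf2 n _
  obtain ⟨w, hw⟩ := Metric.nonempty_iInter_of_nonempty_biInter
    (s := fun n => closure (S n).1) (fun n => isClosed_closure) (fun n => hbdd _)
    (fun N => ⟨(hne N).some, Set.mem_iInter₂.2 fun n hn =>
      subset_closure (hanti hn (hne N).some_mem)⟩) hdiam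
  rw [Set.mem_iInter] at hw
  refine ⟨w, fun δ hδ hnull => ?_, hw 0⟩
  obtain ⟨n, hn⟩ := (hdiam.eventually (gt_mem_nhds hδ)).exists
  refine (S n).2 (hnull.mono fun x hx => ?_)
  exact (Metric.dist_le_diam_of_mem (hbdd _) (subset_closure hx) (hw n)).trans_lt hn

/-- Otherwise a small ball around `w` would lie off the segment from `p` to `q` and be null. -/
theorem dist_add_dist_of_mem_visible (h𝒲 : IsDualizing 𝒲) {w : X}
    (hw : w ∈ visible 𝒲 𝒰 p q) : dist w p + dist w q = dist p q := by
  refine le_antisymm (le_of_not_gt fun h => ?_) (dist_triangle_left p q w)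
  set η := (dist w p + dist w q - dist p q) / 3 with hη
  have hη0 : 0 < η := by rw [hη]; linarith
  refine hw η hη0 ((null_of_le_dist_add_dist h𝒲 hη0).mono fun x hx => ?_)
  rw [Metric.mem_ball] at hx
  have h1 := dist_triangle_left w p x
  have h2 := dist_triangle_left w q x
  simp only [Set.mem_ofPred_eq]
  linarith

/-- Were the distance larger, points near `w'` would have positive excess both relative to `p`, `w`
and relative to `w`, `q`, so `null_of_le_excess` would make a ball around `w'` null. -/
theorem dist_eq_of_mem_visible (h𝒲 : IsDualizing 𝒲) {w w' : X}
    (hw : w ∈ visible 𝒲 𝒰 p q) (hw' : w' ∈ visible 𝒲 𝒰 p q) :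
    dist w w' = |dist w p - dist w' p| := by
  have e1 := dist_add_dist_of_mem_visible h𝒲 hw
  have e2 := dist_add_dist_of_mem_visible h𝒲 hw'
  refine le_antisymm (le_of_not_gt fun h => ?_) (abs_dist_sub_le w w' p)
  obtain ⟨h1, h2⟩ := abs_lt.1 h
  set η := (dist w w' - |dist w p - dist w' p|) / 4 with hη
  have hη0 : 0 < η := by rw [hη]; linarith
  have h3 := le_abs_self (dist w p - dist w' p)
  have h4 := neg_le_abs (dist w p - dist w' p)
  refine hw' η hη0 ((null_of_le_excess h𝒲 w hη0).mono fun x hx => ?_)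
  rw [Metric.mem_ball] at hx
  have h5 := dist_triangle_left w' p x
  have h6 := dist_triangle_left w' q x
  have h7 := dist_triangle_left w' w x
  have h8 := dist_comm w w'
  have h9 := dist_comm p w
  simp only [Set.mem_ofPred_eq, le_min_iff]
  constructor <;> linarith

end Null

/-! ### Functions of the distance to a point -/

section Radial

open MeasureTheory

theorem intervalIntegrable_of_bounded {b : ℝ → ℝ} {M : ℝ} (hb : Measurable b)
    (hM : ∀ t, |b t| ≤ M) (a c : ℝ) : IntervalIntegrable b volume a c :=
  (intervalIntegrable_const (c := M)).mono_fun hb.aestronglyMeasurable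
    (Eventually.of_forall fun t => by
      simpa only [Real.norm_eq_abs] using (hM t).trans (le_abs_self M))

variable {X : Type u} [MetricSpace X] {e : X}

/-- The function `x ↦ ∫ t in 0..dist x p, b t`, normalized to vanish at the base point. -/
noncomputable def radialPrimitive (e p : X) (b : ℝ → ℝ) : LipZero X e :=
  LipZero.ofFun e fun x => ∫ t in (0 : ℝ)..dist x p, b t

section

variable {p : X} {b c : ℝ → ℝ} {M N : ℝ}

theorem lipBd_integral_dist (hb : Measurable b) (hM : ∀ t, |b t| ≤ M) :
    LipBd M fun x => ∫ t in (0 : ℝ)..dist x p, b t := fun x y => by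
  rw [intervalIntegral.integral_interval_sub_left (intervalIntegrable_of_bounded hb hM _ _)
    (intervalIntegrable_of_bounded hb hM _ _)]
  refine (intervalIntegral.norm_integral_le_of_norm_le_const (f := b) (C := M) fun t _ => hM t).trans ?_
  exact mul_le_mul_of_nonneg_left (abs_dist_sub_le x y p) ((abs_nonneg _).trans (hM 0))

theorem radialPrimitive_apply (hb : Measurable b) (hM : ∀ t, |b t| ≤ M) (x : X) :
    radialPrimitive e p b x =
      (∫ t in (0 : ℝ)..dist x p, b t) - ∫ t in (0 : ℝ)..dist e p, b t :=
  (lipBd_integral_dist hb hM).ofFun_apply x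

theorem norm_radialPrimitive_le (hb : Measurable b) (hM : ∀ t, |b t| ≤ M) :
    ‖radialPrimitive e p b‖ ≤ M :=
  (lipBd_integral_dist hb hM).norm_ofFun_le ((abs_nonneg _).trans (hM 0))

theorem radialPrimitive_add (hb : Measurable b) (hM : ∀ t, |b t| ≤ M) (hc : Measurable c)
    (hN : ∀ t, |c t| ≤ N) :
    radialPrimitive e p (fun t => b t + c t) = radialPrimitive e p b + radialPrimitive e p c := by
  refine DFunLike.ext _ _ fun x => ?_
  have hbc : ∀ t, |b t + c t| ≤ M + N := fun t =>
    (abs_add_le _ _).trans (add_le_add (hM t) (hN t))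
  rw [LipZero.add_apply, radialPrimitive_apply hb hM, radialPrimitive_apply hc hN,
    radialPrimitive_apply (b := fun t => b t + c t) (hb.add hc) hbc,
    intervalIntegral.integral_add (intervalIntegrable_of_bounded hb hM _ _)
      (intervalIntegrable_of_bounded hc hN _ _),
    intervalIntegral.integral_add (intervalIntegrable_of_bounded hb hM _ _)
      (intervalIntegrable_of_bounded hc hN _ _)]
  ring

theorem radialPrimitive_const_mul (hb : Measurable b) (hM : ∀ t, |b t| ≤ M) (r : ℝ) :
    radialPrimitive e p (fun t => r * b t) = r • radialPrimitive e p b := by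
  refine DFunLike.ext _ _ fun x => ?_
  have hrb : ∀ t, |r * b t| ≤ |r| * M := fun t => by
    rw [abs_mul]; exact mul_le_mul_of_nonneg_left (hM t) (abs_nonneg r)
  rw [LipZero.smul_apply, radialPrimitive_apply hb hM,
    radialPrimitive_apply (hb.const_mul r) hrb, intervalIntegral.integral_const_mul,
    intervalIntegral.integral_const_mul]
  ring

theorem radialPrimitive_zero : radialPrimitive e p (fun _ => 0) = 0 := by
  refine DFunLike.ext _ _ fun x => ?_
  rw [radialPrimitive_apply (M := 0) measurable_const (by simp)]
  simp

theorem radialPrimitive_sum {κ : Type*} (S : Finset κ) {b : κ → ℝ → ℝ} {M : κ → ℝ}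
    (hb : ∀ k, Measurable (b k)) (hM : ∀ k t, |b k t| ≤ M k) :
    radialPrimitive e p (fun t => ∑ k ∈ S, b k t) = ∑ k ∈ S, radialPrimitive e p (b k) := by
  classical
  induction S using Finset.induction_on with
  | empty => simpa using radialPrimitive_zero
  | insert a S ha ih =>
    simp only [Finset.sum_insert ha]
    rw [radialPrimitive_add (hb a) (hM a) (Finset.measurable_fun_sum S fun k _ => hb k)
      (N := ∑ k ∈ S, M k) (fun t => (Finset.abs_sum_le_sum_abs _ _).trans
        (Finset.sum_le_sum fun k _ => hM k t)), ih]

theorem abs_indicator_one_le (A : Set ℝ) (t : ℝ) : |A.indicator (1 : ℝ → ℝ) t| ≤ 1 := by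
  by_cases h : t ∈ A <;> simp [h]

/-- Indicators of disjoint sets with coefficients in `[-1, 1]` add up to a function bounded by `1`,
so their primitives form an unconditionally bounded series; its pointwise sum comes from countable
additivity of the integral. -/
theorem hasSum_radialPrimitive_indicator {𝒲 : Set (StrongDual ℝ (LipZero X e))}
    (h𝒲 : IsDualizing 𝒲) {A : ℕ → Set ℝ} (hA : ∀ n, MeasurableSet (A n))
    (hdis : Pairwise (Function.onFun Disjoint A)) {φ : StrongDual ℝ (LipZero X e)} (hφ : φ ∈ 𝒲) :
    HasSum (fun n => φ (radialPrimitive e p ((A n).indicator 1)))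
      (φ (radialPrimitive e p ((⋃ n, A n).indicator 1))) := by
  have hm : ∀ {B : Set ℝ}, MeasurableSet B → Measurable (B.indicator (1 : ℝ → ℝ)) :=
    fun hB => measurable_one.indicator hB
  refine LipZero.hasSum_of_unconditional h𝒲 (C := 1) (fun S ε hε => ?_) (fun x => ?_) hφ
  · have h1 : ∑ n ∈ S, ε n • radialPrimitive e p ((A n).indicator 1) =
        radialPrimitive e p (fun t => ∑ n ∈ S, ε n * (A n).indicator 1 t) := by
      rw [radialPrimitive_sum S (M := fun n => |ε n| * 1)
        (fun n => (hm (hA n)).const_mul (ε n)) (fun n t => by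
          rw [abs_mul]
          exact mul_le_mul_of_nonneg_left (abs_indicator_one_le _ t) (abs_nonneg _))]
      exact Finset.sum_congr rfl fun n _ =>
        (radialPrimitive_const_mul (hm (hA n)) (abs_indicator_one_le _) _).symm
    rw [h1]
    refine norm_radialPrimitive_le
      (Finset.measurable_fun_sum S fun n _ => (hm (hA n)).const_mul (ε n)) fun t => ?_
    by_cases ht : ∃ n ∈ S, t ∈ A n
    · obtain ⟨n, hn, htn⟩ := ht
      rw [Finset.sum_eq_single_of_mem n hn fun m _ hmn => by
        rw [Set.indicator_of_notMem (Set.disjoint_left.1 (hdis hmn.symm) htn), mul_zero]]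
      simpa [htn] using hε n
    · push Not at ht
      rw [Finset.sum_eq_zero fun n hn => by rw [Set.indicator_of_notMem (ht n hn), mul_zero]]
      simp
  · have h2 : ∀ u : ℝ, 0 ≤ u → 
        HasSum (fun n => ∫ t in (0 : ℝ)..u, (A n).indicator (1 : ℝ → ℝ) t)
          (∫ t in (0 : ℝ)..u, (⋃ n, A n).indicator (1 : ℝ → ℝ) t) := by
      intro u hu
      simp only [intervalIntegral.integral_of_le hu, integral_indicator (hA _),
        integral_indicator (MeasurableSet.iUnion hA)]
      refine hasSum_integral_iUnion hA hdis ?_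
      exact (integrable_const (1 : ℝ)).integrableOn
    have h3 := ((h2 (dist x p) dist_nonneg).sub (h2 (dist e p) dist_nonneg)).tendsto_sum_nat
    rw [radialPrimitive_apply (hm (MeasurableSet.iUnion hA)) (abs_indicator_one_le _)]
    refine h3.congr fun k => Finset.sum_congr rfl fun n _ => ?_
    rw [radialPrimitive_apply (hm (hA n)) (abs_indicator_one_le _)]

/-- The signed measure `A ↦ φ (radialPrimitive e p (A.indicator 1))`. -/
noncomputable def radialMeasure {𝒲 : Set (StrongDual ℝ (LipZero X e))}
    (h𝒲 : IsDualizing 𝒲) (p : X) {φ : StrongDual ℝ (LipZero X e)} (hφ : φ ∈ 𝒲) :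
    SignedMeasure ℝ where
  measureOf' A := open Classical in
    if MeasurableSet A then φ (radialPrimitive e p (A.indicator 1)) else 0
  empty' := by
    rw [if_pos MeasurableSet.empty, Set.indicator_empty]
    exact (congrArg φ radialPrimitive_zero).trans (map_zero φ)
  not_measurable' A hA := if_neg hA
  m_iUnion' A hA hdis := by
    simp only [if_pos (hA _), if_pos (MeasurableSet.iUnion hA)]
    exact hasSum_radialPrimitive_indicator h𝒲 hA hdis hφ

theorem radialMeasure_apply {𝒲 : Set (StrongDual ℝ (LipZero X e))}
    (h𝒲 : IsDualizing 𝒲) {φ : StrongDual ℝ (LipZero X e)} (hφ : φ ∈ 𝒲) {A : Set ℝ}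
    (hA : MeasurableSet A) :
    radialMeasure h𝒲 p hφ A = φ (radialPrimitive e p (A.indicator 1)) :=
  if_pos hA

theorem radialMeasure_absolutelyContinuous {𝒲 : Set (StrongDual ℝ (LipZero X e))}
    (h𝒲 : IsDualizing 𝒲) {φ : StrongDual ℝ (LipZero X e)} (hφ : φ ∈ 𝒲) :
    VectorMeasure.AbsolutelyContinuous (radialMeasure h𝒲 p hφ)
      (volume : Measure ℝ).toENNRealVectorMeasure := by
  refine VectorMeasure.AbsolutelyContinuous.mk fun A hA h0 => ?_
  rw [Measure.toENNRealVectorMeasure_apply_measurable hA] at h0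
  rw [radialMeasure_apply h𝒲 hφ hA]
  have : radialPrimitive e p (A.indicator 1) = 0 := by
    refine DFunLike.ext _ _ fun x => ?_
    have h1 : ∀ u : ℝ, ∫ t in (0 : ℝ)..u, A.indicator (1 : ℝ → ℝ) t = 0 := fun u => by
      refine intervalIntegral.integral_zero_ae ?_
      filter_upwards [measure_eq_zero_iff_ae_notMem.1 h0] with t ht _
      exact Set.indicator_of_notMem ht _
    rw [radialPrimitive_apply (measurable_one.indicator hA) (abs_indicator_one_le _), h1, h1,
      sub_self, LipZero.zero_apply]
  rw [this, map_zero]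

theorem integrable_bounded_mul {w : ℝ → ℝ} (hw : Integrable w) (hb : Measurable b)
    (hM : ∀ t, |b t| ≤ M) : Integrable fun t => b t * w t :=
  hw.bdd_mul hb.aestronglyMeasurable (Eventually.of_forall fun t => hM t)

/-- The density is the Radon–Nikodym derivative of `radialMeasure`. The formula passes from
indicators to simple functions by linearity, and to bounded `b` by uniform approximation. -/
theorem exists_radial_density {𝒲 : Set (StrongDual ℝ (LipZero X e))}
    (h𝒲 : IsDualizing 𝒲) (p : X) {φ : StrongDual ℝ (LipZero X e)} (hφ : φ ∈ 𝒲) :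
    ∃ w : ℝ → ℝ, Integrable w ∧ ∀ (b : ℝ → ℝ) (M : ℝ), Measurable b → (∀ t, |b t| ≤ M) →
      φ (radialPrimitive e p b) = ∫ t, b t * w t := by
  set w := (radialMeasure h𝒲 p hφ).rnDeriv volume
  have hw : Integrable w := SignedMeasure.integrable_rnDeriv _ _
  have hwA : ∀ A, MeasurableSet A →
      φ (radialPrimitive e p (A.indicator 1)) = ∫ t in A, w t := by
    intro A hA
    rw [← radialMeasure_apply h𝒲 hφ hA, ← withDensityᵥ_apply hw hA,
      SignedMeasure.withDensityᵥ_rnDeriv_eq _ _ (radialMeasure_absolutelyContinuous h𝒲 hφ)]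
  refine ⟨w, hw, fun b M hb hM => ?_⟩
  have hsimple : ∀ f : SimpleFunc ℝ ℝ, φ (radialPrimitive e p f) = ∫ t, f t * w t := by
    intro f
    have hbdd : ∀ f : SimpleFunc ℝ ℝ, ∃ K, ∀ t, |f t| ≤ K := fun f => f.exists_forall_norm_le
    induction f using SimpleFunc.induction with
    | const c hA =>
      rename_i A
      have h1 : ⇑(SimpleFunc.piecewise A hA (SimpleFunc.const ℝ c) (SimpleFunc.const ℝ 0)) =
          fun t => c * A.indicator 1 t := by
        ext t
        by_cases ht : t ∈ A <;> simp [ht]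
      rw [h1, radialPrimitive_const_mul (measurable_one.indicator hA) (abs_indicator_one_le _),
        map_smul, hwA A hA, smul_eq_mul, ← integral_const_mul, ← integral_indicator hA]
      congr 1
      ext t
      by_cases ht : t ∈ A <;> simp [ht]
    | add hfg ihf ihg =>
      rename_i f g
      obtain ⟨K, hK⟩ := hbdd f
      obtain ⟨L, hL⟩ := hbdd g
      have h1 : ⇑(f + g) = fun t => f t + g t := rfl
      rw [h1, radialPrimitive_add f.measurable hK g.measurable hL, map_add, ihf, ihg,
        ← integral_add (integrable_bounded_mul hw f.measurable hK)
          (integrable_bounded_mul hw g.measurable hL)]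
      simp only [add_mul]
  refine eq_of_abs_sub_le_all fun ε hε => ?_
  set K := ‖φ‖ + ∫ t, |w t| with hKdef
  have hK : 0 ≤ K := add_nonneg (norm_nonneg _) (integral_nonneg fun _ => abs_nonneg _)
  obtain ⟨n, hn⟩ := exists_nat_gt (K / ε)
  have hn0 : (0 : ℝ) < n := (div_nonneg hK hε.le).trans_lt hn
  -- Rounding `b` down to multiples of `1 / n` takes finitely many values, hence gives a simple
  -- function.
  let a : ℝ → ℝ := fun t => (⌊(n : ℝ) * b t⌋ : ℝ) / n
  have ham : Measurable a :=
    (measurable_from_top.comp (hb.const_mul (n : ℝ)).floor : Measurable fun t =>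
      (⌊(n : ℝ) * b t⌋ : ℝ)).div_const _
  have hab : ∀ t, |b t - a t| ≤ 1 / n := by
    intro t
    have h1 := Int.floor_le ((n : ℝ) * b t)
    have h2 := Int.lt_floor_add_one ((n : ℝ) * b t)
    have h3 : b t - a t = ((n : ℝ) * b t - ⌊(n : ℝ) * b t⌋) / n := by
      simp only [a]; field_simp
    rw [h3, abs_of_nonneg (div_nonneg (by linarith) hn0.le)]
    exact div_le_div_of_nonneg_right (by linarith) hn0.le
  have hafin : (Set.range a).Finite := by
    refine ((Set.finite_Icc (⌊-(n * M)⌋) ⌊n * M⌋).image fun k : ℤ => (k : ℝ) / n).subset ?_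
    rintro _ ⟨t, rfl⟩
    obtain ⟨h1, h2⟩ := abs_le.1 (hM t)
    refine ⟨⌊(n : ℝ) * b t⌋, ⟨Int.floor_le_floor ?_, Int.floor_le_floor ?_⟩, rfl⟩
    · rw [← mul_neg]
      exact mul_le_mul_of_nonneg_left h1 hn0.le
    · exact mul_le_mul_of_nonneg_left h2 hn0.le
  let f : SimpleFunc ℝ ℝ := ⟨a, fun x => ham (measurableSet_singleton x), hafin⟩
  have hfa : φ (radialPrimitive e p a) = ∫ t, a t * w t := hsimple f
  have hbam : Measurable fun t => b t - a t := hb.sub ham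
  have hsum : radialPrimitive e p b = radialPrimitive e p a +
      radialPrimitive e p (fun t => b t - a t) := by
    obtain ⟨L, hL⟩ := f.exists_forall_norm_le
    rw [← radialPrimitive_add (N := 1 / n) ham hL hbam hab]
    simp only [add_sub_cancel]
  have hint : ∫ t, b t * w t = (∫ t, a t * w t) + ∫ t, (b t - a t) * w t := by
    obtain ⟨L, hL⟩ := f.exists_forall_norm_le
    rw [← integral_add (integrable_bounded_mul hw ham hL) (integrable_bounded_mul hw hbam hab)]
    congr 1
    ext t
    ring
  have e1 : |φ (radialPrimitive e p (fun t => b t - a t))| ≤ ‖φ‖ * (1 / n) :=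
    (φ.le_opNorm _).trans
      (mul_le_mul_of_nonneg_left (norm_radialPrimitive_le hbam hab) (norm_nonneg _))
  have e2 : |∫ t, (b t - a t) * w t| ≤ (∫ t, |w t|) * (1 / n) := by
    rw [mul_comm, ← integral_const_mul]
    refine norm_integral_le_of_norm_le (f := fun t => (b t - a t) * w t)
      (hw.abs.const_mul _) (Eventually.of_forall fun t => ?_)
    rw [norm_mul, Real.norm_eq_abs, Real.norm_eq_abs]
    exact mul_le_mul_of_nonneg_right (hab t) (abs_nonneg _)
  have e3 : K * (1 / n) ≤ ε := by
    rw [div_lt_iff₀ hε] at hn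
    rw [mul_one_div, div_le_iff₀ hn0]
    linarith
  rw [hsum, map_add, hfa, hint, add_sub_add_left_eq_sub]
  refine (abs_sub _ _).trans ?_
  rw [hKdef, add_mul] at e3
  linarith

/-- Uniformly small `1`-Lipschitz functions of `dist x p` are weakly small. -/
theorem tendsto_comp_dist {𝒲 : Set (StrongDual ℝ (LipZero X e))}
    (h𝒲 : IsDualizing 𝒲) (p : X) {φ : StrongDual ℝ (LipZero X e)} (hφ : φ ∈ 𝒲)
    {ι : Type*} {l : Filter ι} {h : ι → ℝ → ℝ} (hh : ∀ i, LipschitzWith 1 (h i)) {ε : ι → ℝ}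
    (hε : ∀ i t, |h i t| ≤ ε i) (hε0 : Tendsto ε l (𝓝 0)) :
    Tendsto (fun i => φ (LipZero.ofFun e fun x => h i (dist x p))) l (𝓝 0) := by
  obtain ⟨w, hw, hφw⟩ := exists_radial_density h𝒲 p hφ
  have hd : ∀ i t, |deriv (h i) t| ≤ 1 := fun i t => by
    simpa using norm_deriv_le_of_lipschitz (x₀ := t) (hh i)
  have hdm : ∀ i, Measurable (deriv (h i)) := fun i => measurable_deriv _
  have hrep : ∀ i, φ (LipZero.ofFun e fun x => h i (dist x p)) = ∫ t, deriv (h i) t * w t := by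
    intro i
    rw [← hφw _ 1 (hdm i) (hd i)]
    congr 1
    refine DFunLike.ext _ _ fun x => ?_
    have h1 : LipBd 1 fun x => h i (dist x p) := fun x y => by
      have := (hh i).dist_le_mul (dist x p) (dist y p)
      rw [Real.dist_eq, Real.dist_eq, NNReal.coe_one, one_mul] at this
      rw [one_mul]
      exact this.trans (abs_dist_sub_le x y p)
    have h2 : ∀ u, ∫ t in (0 : ℝ)..u, deriv (h i) t = h i u - h i 0 := fun u =>
      ((hh i).lipschitzOnWith.absolutelyContinuousOnInterval).integral_deriv_eq_sub
    rw [h1.ofFun_apply, radialPrimitive_apply (hdm i) (hd i), h2, h2]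
    ring
  simp only [hrep]
  rw [Metric.tendsto_nhds]
  intro η hη
  -- Replacing the density by a smooth compactly supported `k` costs at most `η / 2`, uniformly in
  -- `i`; integration by parts then moves the derivative onto `k`, where smallness of `h i`
  -- suffices.
  obtain ⟨k, hkc, hks, hk⟩ := MemLp.exist_eLpNorm_sub_le (p := 1) ENNReal.one_ne_top le_rfl
    (memLp_one_iff_integrable.2 hw) (half_pos hη)
  have hks1 : ContDiff ℝ 1 k := hks.of_le (by exact_mod_cast le_top)
  have hki : Integrable k := hks.continuous.integrable_of_hasCompactSupport hkc
  have hwk : ∫ t, |w t - k t| ≤ η / 2 := by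
    rw [eLpNorm_one_eq_lintegral_enorm] at hk
    have := integral_norm_eq_lintegral_enorm (hw.sub hki).aestronglyMeasurable
    simp only [Real.norm_eq_abs] at this
    refine this.le.trans ?_
    exact ENNReal.toReal_le_of_le_ofReal (half_pos hη).le hk
  have hk' : Integrable (deriv k) :=
    (hks1.continuous_deriv le_rfl).integrable_of_hasCompactSupport hkc.deriv
  obtain ⟨D, hD⟩ := hks1.lipschitzWith_of_hasCompactSupport hkc one_ne_zero
  have hibp : ∀ i, ∫ t, deriv (h i) t * k t = ∫ t, -(deriv k t * h i t) := by
    intro i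
    have hline : ∀ (f : ℝ → ℝ) (t : ℝ), lineDeriv ℝ f t 1 = deriv f t := fun f t => by
      simp [lineDeriv, deriv_comp_const_add]
    have := LipschitzWith.integral_lineDeriv_mul_eq (μ := volume) (hh i) hD hkc (1 : ℝ)
    simpa only [lineDeriv_neg, hline, neg_mul] using this
  have hsmall : ∀ i, |∫ t, deriv (h i) t * k t| ≤ (∫ t, |deriv k t|) * ε i := by
    intro i
    rw [hibp i, ← integral_mul_const]
    refine norm_integral_le_of_norm_le (f := fun t => -(deriv k t * h i t))
      (hk'.abs.mul_const _) (Eventually.of_forall fun t => ?_)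
    rw [norm_neg, norm_mul, Real.norm_eq_abs, Real.norm_eq_abs]
    exact mul_le_mul_of_nonneg_left (hε i t) (abs_nonneg _)
  have hlim : Tendsto (fun i => (∫ t, |deriv k t|) * ε i) l (𝓝 0) := by
    simpa using hε0.const_mul (∫ t, |deriv k t|)
  have hwki : Integrable fun t => w t - k t := hw.sub hki
  filter_upwards [hlim.eventually (gt_mem_nhds (half_pos hη))] with i hi
  rw [Real.dist_eq, sub_zero]
  have h1 : ∫ t, deriv (h i) t * w t =
      (∫ t, deriv (h i) t * k t) + ∫ t, deriv (h i) t * (w t - k t) := by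
    rw [← integral_add (integrable_bounded_mul hki (hdm i) (hd i))
      (integrable_bounded_mul hwki (hdm i) (hd i))]
    congr 1
    ext t
    ring
  have h2 : |∫ t, deriv (h i) t * (w t - k t)| ≤ ∫ t, |w t - k t| := by
    refine norm_integral_le_of_norm_le (f := fun t => deriv (h i) t * (w t - k t)) hwki.abs (Eventually.of_forall fun t => ?_)
    rw [norm_mul, Real.norm_eq_abs, Real.norm_eq_abs]
    exact (mul_le_mul_of_nonneg_right (hd i t) (abs_nonneg _)).trans (one_mul _).le
  rw [h1]
  refine (abs_add_le _ _).trans_lt ?_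
  linarith [hsmall i]

end

end Radial

/-! ### Truncation near a set and the gliding hump -/

section trunc

variable {X : Type u}

/-- The truncation of `g` which agrees with `g` where `ρ ≤ δ` and vanishes where `2 * δ ≤ ρ`
(for `|g| ≤ 2 * ρ`). -/
noncomputable def trunc (ρ : X → ℝ) (δ : ℝ) (g : X → ℝ) (x : X) : ℝ :=
  max (-max 0 (2 * (2 * δ - ρ x))) (min (g x) (max 0 (2 * (2 * δ - ρ x))))

variable {ρ : X → ℝ} {g : X → ℝ} {δ : ℝ}

theorem trunc_eq_self {x : X} (h : ρ x ≤ δ) (hg : |g x| ≤ 2 * ρ x) : trunc ρ δ g x = g x := by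
  have h1 : |g x| ≤ max 0 (2 * (2 * δ - ρ x)) := le_max_of_le_right (by linarith)
  obtain ⟨h2, h3⟩ := abs_le.1 h1
  rw [trunc, min_eq_left h3, max_eq_right h2]

theorem trunc_eq_zero {x : X} (h : 2 * δ ≤ ρ x) : trunc ρ δ g x = 0 := by
  rw [trunc, max_eq_left (by linarith : 2 * (2 * δ - ρ x) ≤ 0), neg_zero,
    max_eq_left (min_le_right _ _)]

/-- The part of `g` living on the annulus `ε < ρ < 2 * δ`. -/
noncomputable def annular (ρ : X → ℝ) (δ ε : ℝ) (g : X → ℝ) (x : X) : ℝ :=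
  trunc ρ δ g x - trunc ρ ε g x

theorem annular_eq_zero_of_le {x : X} {ε : ℝ} (hεδ : ε ≤ δ) (h : ρ x ≤ ε)
    (hg : |g x| ≤ 2 * ρ x) : annular ρ δ ε g x = 0 := by
  rw [annular, trunc_eq_self h hg, trunc_eq_self (h.trans hεδ) hg, sub_self]

theorem annular_eq_zero_of_ge {x : X} {ε : ℝ} (hεδ : ε ≤ δ) (h : 2 * δ ≤ ρ x) :
    annular ρ δ ε g x = 0 := by
  rw [annular, trunc_eq_zero h, trunc_eq_zero (by linarith), sub_self]

end trunc

section Weak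

variable {X : Type u} [MetricSpace X] {e : X}

section trunc

variable {ρ : X → ℝ} {g : X → ℝ} {δ : ℝ}

theorem lipBd_trunc (hρ : LipBd 1 ρ) (hg : LipBd 2 g) : LipBd 2 (trunc ρ δ g) := by
  have h1 : LipBd 2 fun x => 2 * (2 * δ - ρ x) :=
    (((lipBd_const le_rfl (2 * δ)).sub hρ).const_mul 2).mono (by norm_num)
  have h2 : LipBd 2 fun x => max 0 (2 * (2 * δ - ρ x)) := (lipBd_const two_pos.le 0).max h1
  have h3 : LipBd 2 fun x => -max 0 (2 * (2 * δ - ρ x)) := by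
    simpa using h2.const_mul (-1)
  exact h3.max (hg.min h2)

theorem lipBd_annular (hρ : LipBd 1 ρ) (hg : LipBd 2 g) {ε : ℝ} : LipBd 4 (annular ρ δ ε g) :=
  ((lipBd_trunc hρ hg).sub (lipBd_trunc hρ hg)).mono (by norm_num)

theorem ofFun_annular (hρ : LipBd 1 ρ) (hg : LipBd 2 g) {ε : ℝ} :
    LipZero.ofFun e (annular ρ δ ε g) =
      LipZero.ofFun e (trunc ρ δ g) - LipZero.ofFun e (trunc ρ ε g) :=
  (lipBd_trunc hρ hg).ofFun_sub (lipBd_trunc hρ hg)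

end trunc

/-- At each point at most two terms are nonzero, so a difference of values at two points involves at
most four. -/
theorem norm_sum_smul_ofFun_le {a : ℕ → X → ℝ} {K : ℝ} (hK : 0 ≤ K) (ha : ∀ k, LipBd K (a k))
    (hact : ∀ x j k, j + 2 ≤ k → a j x ≠ 0 → a k x = 0) (S : Finset ℕ) (ε : ℕ → ℝ)
    (hε : ∀ n, |ε n| ≤ 1) : ‖∑ k ∈ S, ε k • LipZero.ofFun e (a k)‖ ≤ 4 * K := by
  classical
  have hcard : ∀ x, (S.filter fun k => a k x ≠ 0).card ≤ 2 := by
    intro x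
    by_cases h : ∃ k, a k x ≠ 0
    · refine (Finset.card_le_card (t := {Nat.find h, Nat.find h + 1}) fun k hk => ?_).trans
        Finset.card_le_two
      have hk' := (Finset.mem_filter.1 hk).2
      have h1 := Nat.find_min' h hk'
      have h2 : ¬ Nat.find h + 2 ≤ k := fun h2 => hk' (hact x _ k h2 (Nat.find_spec h))
      simp only [Finset.mem_insert, Finset.mem_singleton]
      omega
    · push Not at h
      simp [h]
  refine LipZero.norm_le (by positivity) fun x y => ?_
  rw [LipZero.sum_apply, LipZero.sum_apply, ← Finset.sum_sub_distrib]
  have hterm : ∀ k, (ε k • LipZero.ofFun e (a k)) x - (ε k • LipZero.ofFun e (a k)) y =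
      ε k * (a k x - a k y) := fun k => by
    rw [LipZero.smul_apply, LipZero.smul_apply, (ha k).ofFun_apply, (ha k).ofFun_apply]
    ring
  simp only [hterm]
  rw [← Finset.sum_filter_of_ne (p := fun k => a k x ≠ 0 ∨ a k y ≠ 0) fun k _ hk => by
    by_contra! h
    simp [h.1, h.2] at hk]
  refine (Finset.abs_sum_le_sum_abs _ _).trans
    ((Finset.sum_le_card_nsmul _ _ (K * dist x y) fun k _ => ?_).trans ?_)
  · rw [abs_mul, ← one_mul (K * dist x y)]
    exact mul_le_mul (hε k) (ha k x y) (abs_nonneg _) zero_le_one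
  · rw [nsmul_eq_mul, mul_assoc]
    refine mul_le_mul_of_nonneg_right ?_ (mul_nonneg hK dist_nonneg)
    rw [Finset.filter_or]
    have := (Finset.card_union_le _ _).trans (add_le_add (hcard x) (hcard y))
    exact_mod_cast this

section Hump

variable {ρ : X → ℝ} {δ : ℕ → ℝ}

theorem antitone_of_halving (hδ0 : ∀ k, 0 < δ k) (hδ : ∀ k, 2 * δ (k + 1) ≤ δ k) : Antitone δ :=
  antitone_nat_of_succ_le fun k => by linarith [hδ k, hδ0 (k + 1)]

theorem tendsto_zero_of_halving (hδ0 : ∀ k, 0 < δ k) (hδ : ∀ k, 2 * δ (k + 1) ≤ δ k) :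
    Tendsto δ atTop (𝓝 0) := by
  have h1 : ∀ k, δ k ≤ δ 0 * (1 / 2) ^ k := by
    intro k
    induction k with
    | zero => simp
    | succ k ih => rw [pow_succ]; linarith [hδ k]
  refine squeeze_zero (fun k => (hδ0 k).le) h1 ?_
  simpa using (tendsto_pow_atTop_nhds_zero_of_lt_one (by norm_num : (0 : ℝ) ≤ 1 / 2)
    (by norm_num)).const_mul (δ 0)

/-- Halving makes annuli whose indices differ by at least two disjoint. -/
theorem norm_sum_annular_le (hρ : LipBd 1 ρ) (hδ0 : ∀ k, 0 < δ k)
    (hδ : ∀ k, 2 * δ (k + 1) ≤ δ k) {g : ℕ → X → ℝ} (hg : ∀ k, LipBd 2 (g k))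
    (hgρ : ∀ k x, |g k x| ≤ 2 * ρ x) (S : Finset ℕ) (ε : ℕ → ℝ) (hε : ∀ n, |ε n| ≤ 1) :
    ‖∑ k ∈ S, ε k • LipZero.ofFun e (annular ρ (δ k) (δ (k + 1)) (g k))‖ ≤ 4 * 4 := by
  have hanti := antitone_of_halving hδ0 hδ
  refine norm_sum_smul_ofFun_le (by norm_num) (fun k => lipBd_annular hρ (hg k))
    (fun x j k hjk hj => ?_) S ε hε
  refine annular_eq_zero_of_ge (hanti (Nat.le_succ k)) ?_
  have h1 : δ (j + 1) ≤ ρ x := le_of_not_gt fun h =>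
    hj (annular_eq_zero_of_le (hanti (Nat.le_succ j)) h.le (hgρ j x))
  have h2 : δ k ≤ δ (j + 2) := hanti hjk
  have h3 := hδ (j + 1)
  linarith

variable {𝒲 : Set (StrongDual ℝ (LipZero X e))} {φ : StrongDual ℝ (LipZero X e)}

/-- The annular pieces telescope, and their pointwise sum is the whole first truncation. The weak
sum is the same, so the remaining truncations are weakly null. -/
theorem tendsto_trunc (h𝒲 : IsDualizing 𝒲) (hφ : φ ∈ 𝒲) (hρ : LipBd 1 ρ) (hρ0 : ∀ x, 0 ≤ ρ x)
    (hδ0 : ∀ k, 0 < δ k) (hδ : ∀ k, 2 * δ (k + 1) ≤ δ k) {g : X → ℝ} (hg : LipBd 2 g)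
    (hgρ : ∀ x, |g x| ≤ 2 * ρ x) :
    Tendsto (fun k => φ (LipZero.ofFun e (trunc ρ (δ k) g))) atTop (𝓝 0) := by
  have hpt : ∀ x, Tendsto (fun k => trunc ρ (δ k) g x) atTop (𝓝 0) := by
    intro x
    rcases (hρ0 x).eq_or_lt with h | h
    · have h0 : g x = 0 := abs_nonpos_iff.1 ((hgρ x).trans (by rw [← h, mul_zero]))
      refine tendsto_const_nhds.congr fun k => ?_
      rw [trunc_eq_self (h ▸ (hδ0 k).le) (hgρ x), h0]
    · refine tendsto_const_nhds.congr' ?_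
      filter_upwards [(tendsto_zero_of_halving hδ0 hδ).eventually (gt_mem_nhds (half_pos h))]
        with k hk
      rw [trunc_eq_zero (by linarith)]
  have htel : ∀ N, ∑ k ∈ Finset.range N, LipZero.ofFun e (annular ρ (δ k) (δ (k + 1)) g) =
      LipZero.ofFun e (trunc ρ (δ 0) g) - LipZero.ofFun e (trunc ρ (δ N) g) := fun N => by
    simp only [ofFun_annular hρ hg]
    exact Finset.sum_range_sub' (fun k => LipZero.ofFun e (trunc ρ (δ k) g)) N
  have h1 := LipZero.hasSum_of_unconditional h𝒲
    (x := fun k => LipZero.ofFun e (annular ρ (δ k) (δ (k + 1)) g))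
    (v := LipZero.ofFun e (trunc ρ (δ 0) g))
    (norm_sum_annular_le hρ hδ0 hδ (fun _ => hg) (fun _ => hgρ)) (fun x => by
      have h2 : ∀ N, ∑ n ∈ Finset.range N,
          LipZero.ofFun e (annular ρ (δ n) (δ (n + 1)) g) x =
          LipZero.ofFun e (trunc ρ (δ 0) g) x - (trunc ρ (δ N) g x - trunc ρ (δ N) g e) :=
        fun N => by
          rw [← LipZero.sum_apply, htel, LipZero.sub_apply, (lipBd_trunc (δ := δ N) hρ hg).ofFun_apply]
      simp only [h2]
      simpa using ((hpt x).sub (hpt e)).const_sub (LipZero.ofFun e (trunc ρ (δ 0) g) x)) hφ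
  have h3 := h1.tendsto_sum_nat.const_sub (φ (LipZero.ofFun e (trunc ρ (δ 0) g)))
  rw [sub_self] at h3
  refine h3.congr fun N => ?_
  rw [← map_sum, htel, map_sub, sub_sub_cancel]

theorem exists_trunc_small_of_fixed (h𝒲 : IsDualizing 𝒲) (hφ : φ ∈ 𝒲) (hρ : LipBd 1 ρ)
    (hρ0 : ∀ x, 0 ≤ ρ x) {g : X → ℝ} (hg : LipBd 2 g) (hgρ : ∀ x, |g x| ≤ 2 * ρ x) {η : ℝ}
    (hη : 0 < η) :
    ∃ δ₀ > 0, ∀ δ, 0 < δ → δ ≤ δ₀ → |φ (LipZero.ofFun e (trunc ρ δ g))| < η := by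
  by_contra! hcon
  have step : ∀ z : {δ : ℝ // 0 < δ ∧ η ≤ |φ (LipZero.ofFun e (trunc ρ δ g))|},
      ∃ z' : {δ : ℝ // 0 < δ ∧ η ≤ |φ (LipZero.ofFun e (trunc ρ δ g))|}, 2 * z'.1 ≤ z.1 := by
    intro z
    obtain ⟨δ, h1, h2, h3⟩ := hcon (z.1 / 2) (half_pos z.2.1)
    exact ⟨⟨δ, h1, h3⟩, by dsimp only; linarith⟩
  choose f hf using step
  obtain ⟨δ, h1, -, h3⟩ := hcon 1 one_pos
  let Z : ℕ → {δ : ℝ // 0 < δ ∧ η ≤ |φ (LipZero.ofFun e (trunc ρ δ g))|} :=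
    fun n => Nat.rec ⟨δ, h1, h3⟩ (fun _ z => f z) n
  have hlim := tendsto_trunc h𝒲 hφ hρ hρ0 (δ := fun n => (Z n).1) (fun n => (Z n).2.1)
    (fun n => hf (Z n)) hg hgρ
  have hlim' := hlim.abs
  rw [abs_zero] at hlim'
  exact absurd (ge_of_tendsto hlim' (Eventually.of_forall fun n => (Z n).2.2)) (not_le.2 hη)

/-- Truncations to small neighbourhoods of `{ρ = 0}` are uniformly weakly small. -/
theorem exists_trunc_small (h𝒲 : IsDualizing 𝒲) (hφ : φ ∈ 𝒲) (hρ : LipBd 1 ρ)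
    (hρ0 : ∀ x, 0 ≤ ρ x) {η : ℝ} (hη : 0 < η) :
    ∃ δ₀ > 0, ∀ δ, 0 < δ → δ ≤ δ₀ → ∀ g : X → ℝ, LipBd 2 g → (∀ x, |g x| ≤ 2 * ρ x) →
      |φ (LipZero.ofFun e (trunc ρ δ g))| ≤ η := by
  by_contra! hcon
  let P : ℝ × (X → ℝ) → Prop := fun z => 0 < z.1 ∧ LipBd 2 z.2 ∧ (∀ x, |z.2 x| ≤ 2 * ρ x) ∧
    η < |φ (LipZero.ofFun e (trunc ρ z.1 z.2))|
  -- Gliding hump: the next radius is so small that truncating the current function to it loses less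
  -- than `η / 2`. Each annular piece then keeps more than `η / 2`, although the series of pieces is
  -- unconditionally bounded.
  have step : ∀ z : {z // P z}, ∃ z' : {z // P z}, 2 * z'.1.1 ≤ z.1.1 ∧
      |φ (LipZero.ofFun e (trunc ρ z'.1.1 z.1.2))| < η / 2 := by
    rintro ⟨z, hz0, hz1, hz2, hz3⟩
    obtain ⟨δ₁, hδ₁, h1⟩ := exists_trunc_small_of_fixed h𝒲 hφ hρ hρ0 hz1 hz2 (half_pos hη)
    obtain ⟨δ, hδ, hδ', g, hg1, hg2, hg3⟩ := hcon (min δ₁ (z.1 / 2)) (lt_min hδ₁ (half_pos hz0))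
    refine ⟨⟨(δ, g), hδ, hg1, hg2, hg3⟩, ?_, h1 δ hδ (hδ'.trans (min_le_left _ _))⟩
    have := hδ'.trans (min_le_right _ _)
    dsimp only
    linarith
  choose f hf1 hf2 using step
  obtain ⟨δ, hδ, -, g, hg1, hg2, hg3⟩ := hcon 1 one_pos
  let Z : ℕ → {z // P z} := fun n => Nat.rec ⟨(δ, g), hδ, hg1, hg2, hg3⟩ (fun _ z => f z) n
  have hsum := summable_of_unconditional (E := LipZero X e)
    (norm_sum_annular_le hρ (δ := fun n => (Z n).1.1) (fun n => (Z n).2.1)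
      (fun n => hf1 (Z n)) (g := fun n => (Z n).1.2) (fun n => (Z n).2.2.1)
      (fun n => (Z n).2.2.2.1)) φ
  have hlim := hsum.tendsto_atTop_zero.abs
  rw [abs_zero] at hlim
  refine absurd (ge_of_tendsto hlim (Eventually.of_forall fun n => ?_)) (not_le.2 (half_pos hη))
  have h1 := (Z n).2.2.2.2
  have h2 : |φ (LipZero.ofFun e (trunc ρ (Z (n + 1)).1.1 (Z n).1.2))| < η / 2 := hf2 (Z n)
  rw [ofFun_annular hρ (Z n).2.2.1, map_sub]
  have h3 := abs_sub_abs_le_abs_sub (φ (LipZero.ofFun e (trunc ρ (Z n).1.1 (Z n).1.2)))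
    (φ (LipZero.ofFun e (trunc ρ (Z (n + 1)).1.1 (Z n).1.2)))
  linarith

end Hump

/-! ### Weak limits of pointwise null families -/

section Ultra

variable {𝒲 : Set (StrongDual ℝ (LipZero X e))} {ι : Type*} {𝒰 : Ultrafilter ι}

/-- A finite net suffices because the family is equi-Lipschitz. -/
theorem exists_uniform_bound_of_totallyBounded {D : ℝ} (hD : ∀ x y : X, dist x y ≤ D)
    {F : Set X} (hF : TotallyBounded F) (hne : F.Nonempty) {l : Filter ι} {f : ι → LipZero X e}
    (hf : ∀ i, ‖f i‖ ≤ 1) (hf0 : ∀ x, Tendsto (fun i => f i x) l (𝓝 0)) :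
    ∃ ε : ι → ℝ, Tendsto ε l (𝓝 0) ∧ ∀ i, ∀ w ∈ F, |f i w| ≤ ε i := by
  have hlip : ∀ i x y, |f i x - f i y| ≤ dist x y := fun i x y =>
    ((f i).abs_sub_le x y).trans (mul_le_of_le_one_left dist_nonneg (hf i))
  have hbdd : ∀ i, BddAbove (Set.range fun w : F => |f i w|) := fun i => by
    refine ⟨D, ?_⟩
    rintro _ ⟨w, rfl⟩
    simpa using (hlip i w e).trans (hD _ _)
  have : Nonempty F := hne.to_subtype
  refine ⟨fun i => ⨆ w : F, |f i w|, ?_, fun i w hw => le_ciSup (hbdd i) ⟨w, hw⟩⟩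
  rw [Metric.tendsto_nhds]
  intro η hη
  obtain ⟨t, htf, ht⟩ := Metric.totallyBounded_iff.1 hF (η / 3) (by positivity)
  have h1 : ∀ᶠ i in l, ∀ y ∈ t, |f i y| < η / 3 := by
    rw [eventually_all_finite htf]
    intro y _
    have := (hf0 y).abs
    rw [abs_zero] at this
    exact this.eventually (gt_mem_nhds (by positivity))
  filter_upwards [h1] with i hi
  rw [Real.dist_eq, sub_zero, abs_of_nonneg (Real.iSup_nonneg fun _ => abs_nonneg _)]
  refine (ciSup_le fun w => ?_).trans_lt (by linarith : η / 3 + η / 3 < η)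
  obtain ⟨y, hy, hwy⟩ := Set.mem_iUnion₂.1 (ht w.2)
  rw [Metric.mem_ball] at hwy
  have h2 := hlip i w y
  have h3 := abs_sub_abs_le_abs_sub (f i w) (f i y)
  linarith [hi y hy]

theorem totallyBounded_visible (h𝒲 : IsDualizing 𝒲) {D : ℝ} (hD : ∀ x y : X, dist x y ≤ D)
    (p q : X) : TotallyBounded (visible 𝒲 𝒰 p q) := by
  set F := visible 𝒲 𝒰 p q
  have hiso : Isometry fun w : F => dist (w : X) p := Isometry.of_dist_eq fun w w' => by
    rw [Real.dist_eq, Subtype.dist_eq, dist_eq_of_mem_visible h𝒲 w.2 w'.2]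
  have h1 : TotallyBounded (Set.univ : Set F) :=
    (totallyBounded_preimage hiso.isUniformInducing (totallyBounded_Icc 0 D)).subset
      fun w _ => Set.mem_preimage.2 (Set.mem_Icc.2 ⟨dist_nonneg, hD _ _⟩)
  simpa using h1.image uniformContinuous_subtype_val

/-- A pointwise null family on `F` extends to functions of the distance to `p`, if this distance
is an isometry on `F`. -/
theorem exists_radial_extension {F : Set X} {p : X}
    (hF : ∀ w ∈ F, ∀ w' ∈ F, dist w w' = |dist w p - dist w' p|) {f : LipZero X e}
    (hf : ‖f‖ ≤ 1) {ε : ℝ} (hε : 0 ≤ ε) (hfε : ∀ w ∈ F, |f w| ≤ ε) :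
    ∃ h : ℝ → ℝ, LipschitzWith 1 h ∧ (∀ t, |h t| ≤ ε) ∧ ∀ w ∈ F, h (dist w p) = f w := by
  rcases F.eq_empty_or_nonempty with rfl | ⟨w₀, -⟩
  · exact ⟨fun _ => 0, LipschitzWith.const' 0, fun _ => by simpa using hε, by simp⟩
  have : Nonempty X := ⟨w₀⟩
  let s : X → ℝ := fun x => dist x p
  have hinj : Set.InjOn s F := fun w hw w' hw' h => by
    rw [← dist_eq_zero, hF w hw w' hw']
    simpa [s, sub_eq_zero] using h
  have hinv : ∀ w ∈ F, Function.invFunOn s F (s w) = w := fun w hw =>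
    hinj.leftInvOn_invFunOn hw
  have hlip : LipschitzOnWith 1 (fun t => f (Function.invFunOn s F t)) (s '' F) := by
    refine LipschitzOnWith.of_dist_le_mul ?_
    rintro _ ⟨w, hw, rfl⟩ _ ⟨w', hw', rfl⟩
    rw [hinv w hw, hinv w' hw', Real.dist_eq, Real.dist_eq, NNReal.coe_one, one_mul,
      ← hF w hw w' hw']
    exact (f.abs_sub_le w w').trans (mul_le_of_le_one_left dist_nonneg hf)
  obtain ⟨h, hh, heq⟩ := hlip.extend_real
  refine ⟨fun t => max (-ε) (min (h t) ε), (hh.min_const ε).const_max (-ε), fun t => ?_,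
    fun w hw => ?_⟩
  · exact abs_le.2 ⟨le_max_left _ _, max_le (by linarith) (min_le_right _ _)⟩
  · have h1 : h (dist w p) = f w := by
      rw [← heq ⟨w, hw, rfl⟩]
      exact congrArg f (hinv w hw)
    obtain ⟨h2, h3⟩ := abs_le.1 (hfε w hw)
    simp only [h1]
    rw [min_eq_left h3, max_eq_right h2]

/-- Limits, in the weak topology of a dualizing family, of bounded pointwise null families vanish
identically. -/
theorem apply_eq_apply_of_pointwise_null [CompleteSpace X] (h𝒲 : IsDualizing 𝒲) {D : ℝ}
    (hD : ∀ x y : X, dist x y ≤ D) {f : ι → LipZero X e} (hf : ∀ i, ‖f i‖ ≤ 1)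
    (hf0 : ∀ x, Tendsto (fun i => f i x) 𝒰 (𝓝 0)) {d : LipZero X e}
    (hd : ∀ φ ∈ 𝒲, Tendsto (fun i => φ (f i)) 𝒰 (𝓝 (φ d))) (p q : X) : d p = d q := by
  set F := visible 𝒲 𝒰 p q with hFdef
  have hNull : ∀ A : Set X, (∀ w ∈ F, w ∉ closure A) → Null 𝒲 𝒰 p q A := fun A hA => by
    by_contra h
    obtain ⟨w, hw, hw'⟩ := exists_visible_mem_closure h𝒲 hD h
    exact hA w hw hw'
  rcases F.eq_empty_or_nonempty with hF | hne
  -- With no visible points the whole space is null.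
  · exact hNull Set.univ (by simp [hF]) f 1 d hf (fun i => ⟨0, fun x hx => absurd trivial hx⟩) hd
  obtain ⟨ε, hε, hfε⟩ := exists_uniform_bound_of_totallyBounded hD
    (totallyBounded_visible h𝒲 hD p q : TotallyBounded F) hne hf hf0
  have hε0 : ∀ i, 0 ≤ ε i := fun i => (abs_nonneg _).trans (hfε i _ hne.some_mem)
  choose h hh hhε hhf using fun i => exists_radial_extension (F := F) (p := p)
    (fun w hw w' hw' => dist_eq_of_mem_visible h𝒲 hw hw') (hf i) (hε0 i) (hfε i)
  set ρ : X → ℝ := fun x => Metric.infDist x F with hρdef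
  have hρ : LipBd 1 ρ := fun x y => by
    have := (Metric.lipschitz_infDist_pt F).dist_le_mul x y
    rwa [Real.dist_eq, NNReal.coe_one] at this
  have hρ0 : ∀ x, 0 ≤ ρ x := fun x => Metric.infDist_nonneg
  set R := max D 1 with hR
  have hρR : ∀ x, ρ x ≤ R := fun x =>
    ((Metric.infDist_le_dist_of_mem hne.some_mem).trans (hD _ _)).trans (le_max_left _ _)
  have hhs : ∀ i, LipBd 1 fun x => h i (dist x p) := fun i x y => by
    have := (hh i).dist_le_mul (dist x p) (dist y p)
    rw [Real.dist_eq, Real.dist_eq, NNReal.coe_one, one_mul] at this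
    rw [one_mul]
    exact this.trans (abs_dist_sub_le x y p)
  set g : ι → X → ℝ := fun i x => f i x - h i (dist x p) with hgdef
  have hg : ∀ i, LipBd 2 (g i) := fun i =>
    (((f i).lipBd.mono (hf i)).sub (hhs i)).mono (by norm_num)
  have hgF : ∀ i, ∀ w ∈ F, g i w = 0 := fun i w hw => by
    simp only [hgdef, hhf i w hw, sub_self]
  -- `g i` is `2`-Lipschitz and vanishes on `F`.
  have hgρ : ∀ i x, |g i x| ≤ 2 * ρ x := fun i x => by
    by_contra! hlt
    obtain ⟨w, hw, hxw⟩ := (Metric.infDist_lt_iff hne).1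
      (show Metric.infDist x F < |g i x| / 2 by simp only [hρdef] at hlt; linarith)
    have := hg i x w
    rw [hgF i w hw, sub_zero] at this
    linarith
  have hgd : ∀ φ ∈ 𝒲, Tendsto (fun i => φ (LipZero.ofFun e (g i))) 𝒰 (𝓝 (φ d)) := by
    intro φ hφ
    have h1 := (hd φ hφ).sub (tendsto_comp_dist h𝒲 p hφ hh hhε hε)
    rw [sub_zero] at h1
    refine h1.congr fun i => ?_
    rw [← map_sub, (f i).lipBd.ofFun_sub (hhs i), LipZero.ofFun_coe]
  set δ : ℕ → ℝ := fun j => R / 2 ^ j with hδdef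
  have hR0 : 0 < R := lt_max_of_lt_right one_pos
  have hδ0 : ∀ j, 0 < δ j := fun j => by positivity
  have hδ : ∀ j, 2 * δ (j + 1) ≤ δ j := fun j => by
    simp only [hδdef, pow_succ]
    field_simp
    exact le_rfl
  have hanti := antitone_of_halving hδ0 hδ
  choose dd _ hdd using fun j => h𝒲.exists_tendsto 𝒰
    (z := fun i => LipZero.ofFun e (annular ρ (δ j) (δ (j + 1)) (g i))) (C := 4)
    (Eventually.of_forall fun i => (lipBd_annular hρ (hg i)).norm_ofFun_le (by norm_num))
  -- The `j`-th piece is constant off a closed set disjoint from `F`, which is null.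
  have hdpq : ∀ j, dd j p = dd j q := by
    intro j
    refine hNull {x | δ (j + 1) ≤ ρ x} (fun w hw hwc => ?_)
      (fun i => LipZero.ofFun e (annular ρ (δ j) (δ (j + 1)) (g i))) 4 (dd j)
      (fun i => (lipBd_annular hρ (hg i)).norm_ofFun_le (by norm_num))
      (fun i => ⟨0 - annular ρ (δ j) (δ (j + 1)) (g i) e, fun x hx => ?_⟩) (hdd j)
    · rw [(isClosed_le continuous_const hρ.continuous).closure_eq] at hwc
      have h1 : δ (j + 1) ≤ ρ w := hwc
      rw [hρdef] at h1
      simp only [Metric.infDist_zero_of_mem hw] at h1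
      exact absurd h1 (not_le.2 (hδ0 _))
    · rw [(lipBd_annular hρ (hg i)).ofFun_apply,
        annular_eq_zero_of_le (hanti (Nat.le_succ j)) (le_of_not_ge hx) (hgρ i x)]
  obtain ⟨v, hv1, hv2⟩ := LipZero.exists_hasSum_of_unconditional h𝒲 (x := dd) (C := 4 * 4)
    fun S κ hκ => by
      refine h𝒲.norm_le_of_tendsto (l := (𝒰 : Filter ι)) (z := fun i =>
          ∑ j ∈ S, κ j • LipZero.ofFun e (annular ρ (δ j) (δ (j + 1)) (g i)))
        (Eventually.of_forall fun i => norm_sum_annular_le hρ hδ0 hδ (fun _ => hg i)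
          (fun _ => hgρ i) S κ hκ) fun φ hφ => ?_
      simp only [map_sum, map_smul]
      exact tendsto_finsetSum _ fun j _ => (hdd j φ hφ).const_smul _
  -- Since `δ 0 = R` bounds `ρ`, the first truncation is `g i` itself. After `J` pieces only the
  -- truncation at `δ J` remains, and `exists_trunc_small` bounds it uniformly in `i`, so summation
  -- and the limit along `𝒰` may be exchanged.
  have hvd : d = v := h𝒲.ext fun φ hφ => by
    refine eq_of_abs_sub_le_all fun η hη => ?_
    obtain ⟨δ₀, hδ₀, hsmall⟩ := exists_trunc_small h𝒲 hφ hρ hρ0 hη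
    refine le_of_tendsto (((hv2 φ hφ).tendsto_sum_nat.const_sub (φ d)).abs) ?_
    filter_upwards [(tendsto_zero_of_halving hδ0 hδ).eventually (ge_mem_nhds hδ₀)] with J hJ
    have h1 := (hgd φ hφ).sub (tendsto_finsetSum (Finset.range J) fun j _ => hdd j φ hφ)
    refine le_of_tendsto h1.abs (Eventually.of_forall fun i => ?_)
    have h2 : trunc ρ (δ 0) (g i) = g i := funext fun x =>
      trunc_eq_self (by simpa [hδdef] using hρR x) (hgρ i x)
    have h3 : ∑ j ∈ Finset.range J, φ (LipZero.ofFun e (annular ρ (δ j) (δ (j + 1)) (g i))) =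
        φ (LipZero.ofFun e (g i)) - φ (LipZero.ofFun e (trunc ρ (δ J) (g i))) := by
      simp only [ofFun_annular hρ (hg i), map_sub]
      rw [Finset.sum_range_sub' (fun j => φ (LipZero.ofFun e (trunc ρ (δ j) (g i)))), h2]
    rw [h3, sub_sub_cancel]
    exact hsmall _ (hδ0 J) hJ (g i) (hg i) (hgρ i)
  have h4 := hv1 p
  simp only [hdpq] at h4
  rw [hvd]
  exact h4.unique (hv1 q)

end Ultra

end Weak

/-! ### The closed span of the evaluations as a predual -/

section

variable {X : Type u} [MetricSpace X] {e : X}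

/-- The closed linear span of the evaluation functionals on `LipZero X e`. -/
noncomputable def evalSpan (X : Type u) [MetricSpace X] (e : X) :
    Submodule ℝ (StrongDual ℝ (LipZero X e)) :=
  (Submodule.span ℝ (Set.range (LipZero.eval e))).topologicalClosure

theorem LipZero.eval_mem_evalSpan (p : X) : LipZero.eval e p ∈ evalSpan X e :=
  Submodule.le_topologicalClosure _ (Submodule.subset_span ⟨p, rfl⟩)

/-- Hahn–Banach extends the restriction of `φ` to the functions vanishing on `K` to some `ψ` of
small norm. Then `φ - ψ` vanishes on a finite intersection of kernels of evaluations, so it is a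
combination of them. -/
theorem mem_evalSpan_of_small {φ : StrongDual ℝ (LipZero X e)}
    (h : ∀ ε > 0, ∃ K : Finset X, ∀ f : LipZero X e, (∀ x ∈ K, f x = 0) → |φ f| ≤ ε * ‖f‖) :
    φ ∈ evalSpan X e := by
  refine Metric.mem_closure_iff.2 fun ε hε => ?_
  obtain ⟨K, hK⟩ := h (ε / 2) (half_pos hε)
  let L : K → LipZero X e →ₗ[ℝ] ℝ := fun x => (LipZero.eval e (x : X)).toLinearMap
  let M : Submodule ℝ (LipZero X e) := ⨅ x, LinearMap.ker (L x)
  have hM : ∀ f ∈ M, ∀ x ∈ K, f x = 0 := fun f hf x hx => by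
    have := (Submodule.mem_iInf _).1 hf ⟨x, hx⟩
    exact LinearMap.mem_ker.1 this
  obtain ⟨ψ, hψ, hψn⟩ := exists_extension_norm_eq M (φ.comp M.subtypeL)
  have hψε : ‖ψ‖ ≤ ε / 2 := by
    rw [hψn]
    exact ContinuousLinearMap.opNorm_le_bound _ (half_pos hε).le fun f => hK f (hM f f.2)
  have hker : M ≤ LinearMap.ker ((φ - ψ).toLinearMap) := fun f hf => by
    have h1 : ψ f = φ f := hψ ⟨f, hf⟩
    simp [h1]
  obtain ⟨c, hc⟩ := (Submodule.mem_span_range_iff_exists_fun ℝ).1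
    (mem_span_of_iInf_ker_le_ker hker)
  refine ⟨φ - ψ, ?_, ?_⟩
  · have : φ - ψ = ∑ x : K, c x • LipZero.eval e (x : X) := by
      ext f
      have := congrArg (fun l : LipZero X e →ₗ[ℝ] ℝ => l f) hc
      simpa [L] using this.symm
    rw [this]
    exact Submodule.sum_mem _ fun x _ =>
      Submodule.smul_mem _ _ (Submodule.subset_span ⟨_, rfl⟩)
  · rw [dist_eq_norm, sub_sub_cancel]
    linarith

/-- Otherwise each finite `K` admits a unit-ball function vanishing on `K` with `|φ f| ≥ ε`. Along
an ultrafilter finer than `atTop` on finite sets these are pointwise null, so their `𝒲`-limit is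
`0`, contradicting the lower bound. -/
theorem IsDualizing.mem_evalSpan [CompleteSpace X] {𝒲 : Set (StrongDual ℝ (LipZero X e))}
    (h𝒲 : IsDualizing 𝒲) {D : ℝ} (hD : ∀ x y : X, dist x y ≤ D)
    {φ : StrongDual ℝ (LipZero X e)} (hφ : φ ∈ 𝒲) : φ ∈ evalSpan X e := by
  refine mem_evalSpan_of_small ?_
  by_contra! hcon
  obtain ⟨ε, hε, hcon⟩ := hcon
  have hunit : ∀ K : Finset X, ∃ f : LipZero X e, ‖f‖ ≤ 1 ∧ (∀ x ∈ K, f x = 0) ∧ ε ≤ |φ f| := by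
    intro K
    obtain ⟨f, hf, hφf⟩ := hcon K
    have hf0 : 0 < ‖f‖ := by
      rw [norm_pos_iff]
      rintro rfl
      simp at hφf
    refine ⟨‖f‖⁻¹ • f, ?_, fun x hx => by rw [LipZero.smul_apply, hf x hx, mul_zero], ?_⟩
    · rw [norm_smul, norm_inv, norm_norm, inv_mul_cancel₀ hf0.ne']
    · rw [map_smul, smul_eq_mul, abs_mul, abs_of_pos (inv_pos.2 hf0), inv_mul_eq_div,
        le_div_iff₀ hf0]
      exact hφf.le
  choose f hf1 hf0 hfε using hunit
  let 𝒰 : Ultrafilter (Finset X) := Ultrafilter.of atTop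
  have hpt : ∀ x, Tendsto (fun K => f K x) 𝒰 (𝓝 0) := fun x => by
    refine Tendsto.mono_left ?_ (Ultrafilter.of_le atTop)
    refine tendsto_const_nhds.congr' ?_
    filter_upwards [eventually_ge_atTop {x}] with K hK
    exact (hf0 K x (hK (Finset.mem_singleton_self x))).symm
  obtain ⟨d, -, hd⟩ := h𝒲.exists_tendsto 𝒰 (Eventually.of_forall hf1)
  have hd0 : d = 0 := DFunLike.ext _ _ fun p => by
    rw [apply_eq_apply_of_pointwise_null h𝒲 hD hf1 hpt hd p e, LipZero.apply_base,
      LipZero.zero_apply]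
  have hlim := (hd φ hφ).abs
  rw [hd0, map_zero, abs_zero] at hlim
  exact absurd (ge_of_tendsto hlim (Eventually.of_forall hfε)) (not_le.2 hε)

theorem LipZero.norm_eval_sub_le (p q : X) :
    ‖LipZero.eval e p - LipZero.eval e q‖ ≤ dist p q :=
  ContinuousLinearMap.opNorm_le_bound _ dist_nonneg fun f => by
    rw [mul_comm]
    exact f.abs_sub_le p q

variable {V : Type*} [NormedAddCommGroup V] [NormedSpace ℝ V]
  {J : V →ₗᵢ[ℝ] StrongDual ℝ (LipZero X e)}

/-- The canonical map of `LipZero X e` into the dual of a space of functionals that contains the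
evaluations. -/
noncomputable def toDualOfEval (hJ : ∀ p, LipZero.eval e p ∈ Set.range J) :
    LipZero X e →ₗᵢ[ℝ] StrongDual ℝ V where
  toFun f := (NormedSpace.inclusionInDoubleDual ℝ (LipZero X e) f).comp J.toContinuousLinearMap
  map_add' f g := by ext; simp
  map_smul' c f := by ext; simp
  norm_map' f := by
    refine le_antisymm (ContinuousLinearMap.opNorm_le_bound _ (norm_nonneg f) fun v => ?_)
      (LipZero.norm_le (norm_nonneg _) fun p q => ?_)
    · rw [mul_comm, ← J.norm_map v]
      exact (J v).le_opNorm f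
    · obtain ⟨a, ha⟩ := hJ p
      obtain ⟨b, hb⟩ := hJ q
      have h1 := ContinuousLinearMap.le_opNorm ((NormedSpace.inclusionInDoubleDual ℝ
        (LipZero X e) f).comp J.toContinuousLinearMap) (a - b)
      have h2 : ‖a - b‖ ≤ dist p q := by
        rw [← J.norm_map, map_sub, ha, hb]
        exact LipZero.norm_eval_sub_le p q
      have h3 : ((NormedSpace.inclusionInDoubleDual ℝ (LipZero X e) f).comp
          J.toContinuousLinearMap) (a - b) = f p - f q := by
        simp [ha, hb]
      rw [h3] at h1
      exact h1.trans (mul_le_mul_of_nonneg_left h2 (norm_nonneg _))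

@[simp] theorem toDualOfEval_apply (hJ : ∀ p, LipZero.eval e p ∈ Set.range J) (f : LipZero X e)
    (v : V) : toDualOfEval hJ f v = J v f := rfl

/-- The preimage of `ξ` is the function `p ↦ ξ (v p)`, where `v p` represents evaluation at `p`.
Both functionals agree on a closed subspace containing the evaluations, hence everywhere. -/
theorem toDualOfEval_surjective [CompleteSpace V] (hJ : ∀ p, LipZero.eval e p ∈ Set.range J)
    (hJ' : ∀ v, J v ∈ evalSpan X e) : Function.Surjective (toDualOfEval hJ) := by
  intro ξ
  choose v hv using id hJ
  have hlip : LipBd ‖ξ‖ fun p => ξ (v p) := fun p q => by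
    rw [← map_sub]
    refine (ξ.le_opNorm _).trans (mul_le_mul_of_nonneg_left ?_ (norm_nonneg _))
    rw [← J.norm_map, map_sub, hv, hv]
    exact LipZero.norm_eval_sub_le p q
  have hbase : v e = 0 := J.injective (by rw [hv, map_zero]; ext f; simp)
  set f := LipZero.ofFun e fun p => ξ (v p) with hf
  have hfp : ∀ p, f p = ξ (v p) := fun p => by
    rw [hf, hlip.ofFun_apply, hbase, map_zero, sub_zero]
  refine ⟨f, ?_⟩
  let M : Submodule ℝ V := LinearMap.ker (toDualOfEval hJ f - ξ).toLinearMap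
  have hMc : IsClosed (M : Set V) := (toDualOfEval hJ f - ξ).isClosed_ker
  have hJM : IsClosed ((M.map J.toLinearMap : Submodule ℝ _) : Set (StrongDual ℝ (LipZero X e))) :=
    J.isometry.isClosedEmbedding.isClosedMap _ hMc
  have hle : evalSpan X e ≤ M.map J.toLinearMap := by
    refine Submodule.topologicalClosure_minimal _ (Submodule.span_le.2 ?_) hJM
    rintro _ ⟨p, rfl⟩
    refine ⟨v p, ?_, hv p⟩
    simp [M, hv, hfp]
  ext w
  obtain ⟨w', hw', hww'⟩ := hle (hJ' w)
  have : w' = w := J.injective hww'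
  subst this
  simpa [M, sub_eq_zero] using hw'

end

/-- The predual of a dual space, transported through an isometry, is dualizing. -/
theorem isDualizing_range {E W : Type*} [NormedAddCommGroup E] [NormedSpace ℝ E]
    [NormedAddCommGroup W] [NormedSpace ℝ W] (T : E ≃ₗᵢ[ℝ] StrongDual ℝ W) :
    IsDualizing (Set.range fun w => (NormedSpace.inclusionInDoubleDual ℝ W w).comp
      (T.toContinuousLinearEquiv : E →L[ℝ] StrongDual ℝ W)) where
  eq_zero d hd := by
    refine T.map_eq_zero_iff.1 ?_
    ext w
    exact hd _ ⟨w, rfl⟩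
  exists_lim C 𝒢 hC := by
    have hcpt : IsCompact (WeakDual.toStrongDual ⁻¹' Metric.closedBall (0 : StrongDual ℝ W) C) :=
      WeakDual.isCompact_closedBall 0 C
    obtain ⟨x, hx, hlim⟩ := hcpt.ultrafilter_le_nhds
      (𝒢.map fun f => StrongDual.toWeakDual (T f)) (by
        rw [le_principal_iff, Ultrafilter.mem_coe, Ultrafilter.mem_map]
        refine mem_of_superset (x := {f | ‖f‖ ≤ C}) hC fun f hf => ?_
        simpa using hf)
    refine ⟨T.symm (WeakDual.toStrongDual x), by simpa using hx, ?_⟩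
    rintro _ ⟨w, rfl⟩
    have h1 : Tendsto (fun f => StrongDual.toWeakDual (T f)) 𝒢 (𝓝 x) := hlim
    have h2 := ((WeakDual.eval_continuous w).tendsto x).comp h1
    refine (h2.congr fun f => rfl).trans_eq (congrArg 𝓝 ?_)
    simp

theorem HasStronglyUniquePredual.congr {E F : Type u} [NormedAddCommGroup E] [NormedSpace ℝ E]
    [NormedAddCommGroup F] [NormedSpace ℝ F] (T : E ≃ₗᵢ[ℝ] F)
    (h : HasStronglyUniquePredual.{u, v} F) : HasStronglyUniquePredual.{u, v} E := by
  obtain ⟨V, i1, i2, i3, ⟨S⟩, hV⟩ := h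
  exact ⟨V, i1, i2, i3, ⟨T.trans S⟩, hV⟩

/-- Weak* continuity is tested at each `w : W`. Transported to `LipZero X e`, evaluation at `w` lies
in `evalSpan X e`, so it is represented by some `v : V`, and evaluation at `v` is weak* continuous.
-/
theorem continuous_weakDual_of_eval {X : Type u} [MetricSpace X] [CompleteSpace X] {e : X}
    {D : ℝ} (hD : ∀ x y : X, dist x y ≤ D) {V : Type*} [NormedAddCommGroup V] [NormedSpace ℝ V]
    [CompleteSpace V] {J : V →ₗᵢ[ℝ] StrongDual ℝ (LipZero X e)}
    (hJ : ∀ φ, φ ∈ Set.range J ↔ φ ∈ evalSpan X e) :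
    Nonempty (LipZero X e ≃ₗᵢ[ℝ] StrongDual ℝ V) ∧
    ∀ (W : Type v) [NormedAddCommGroup W] [NormedSpace ℝ W] [CompleteSpace W]
      (T : StrongDual ℝ V ≃ₗᵢ[ℝ] StrongDual ℝ W),
      Continuous fun x : WeakDual ℝ V =>
        StrongDual.toWeakDual (T (WeakDual.toStrongDual x)) := by
  have hJe : ∀ p, LipZero.eval e p ∈ Set.range J :=
    fun p => (hJ _).2 (LipZero.eval_mem_evalSpan p)
  let S : LipZero X e ≃ₗᵢ[ℝ] StrongDual ℝ V := LinearIsometryEquiv.ofSurjective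
    (toDualOfEval hJe) (toDualOfEval_surjective hJe fun v => (hJ _).1 ⟨v, rfl⟩)
  refine ⟨⟨S⟩, fun W _ _ _ T => WeakDual.continuous_of_continuous_eval fun w => ?_⟩
  obtain ⟨v, hv⟩ := (hJ _).2 ((isDualizing_range (S.trans T)).mem_evalSpan hD ⟨w, rfl⟩)
  refine (WeakDual.eval_continuous v).congr fun x => ?_
  obtain ⟨f, hf⟩ := S.surjective (WeakDual.toStrongDual x)
  have h1 : x v = S f v := by rw [hf]; rfl
  have h2 : S f v = J v f := rfl
  rw [h1, h2, hv, ← hf]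
  rfl

theorem hasStronglyUniquePredual_of_completeSpace (X : Type u) [MetricSpace X] [CompleteSpace X]
    (e : X) {D : ℝ} (hD : ∀ x y : X, dist x y ≤ D) :
    HasStronglyUniquePredual.{u, v} (LipZero X e) := by
  have hcomplete : CompleteSpace (evalSpan X e) :=
    (Submodule.isClosed_topologicalClosure _).completeSpace_coe
  exact ⟨evalSpan X e, inferInstance, inferInstance, hcomplete,
    continuous_weakDual_of_eval hD (J := (evalSpan X e).subtypeₗᵢ) fun φ =>
      ⟨by rintro ⟨v, rfl⟩; exact v.2, fun h => ⟨⟨φ, h⟩, rfl⟩⟩⟩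

/-! ### Passage to the completion -/

section Completion

open UniformSpace

variable (X : Type u) [MetricSpace X] (e : X)

/-- Restriction of Lipschitz functions from the completion. -/
noncomputable def completionRestrict :
    LipZero (Completion X) (e : Completion X) →ₗᵢ[ℝ] LipZero X e where
  toFun f := ⟨fun x => f x, by
    obtain ⟨K, hK⟩ := f.2.1
    exact ⟨K * 1, hK.comp Completion.coe_isometry.lipschitz⟩, f.apply_base⟩
  map_add' _ _ := rfl
  map_smul' _ _ := rfl
  norm_map' f := by
    refine le_antisymm (LipZero.norm_le (norm_nonneg _) fun p q => ?_)
      (LipZero.norm_le (norm_nonneg _) fun a b => ?_)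
    · rw [← Completion.dist_eq p q]
      exact f.abs_sub_le p q
    · have hf : Continuous f := f.lipBd.continuous
      induction a, b using Completion.induction_on₂ with
      | hp =>
        refine isClosed_le ?_ ?_
        · exact ((hf.comp continuous_fst).sub (hf.comp continuous_snd)).abs
        · exact continuous_const.mul continuous_dist
      | ih p q =>
        rw [Completion.dist_eq p q]
        exact LipZero.abs_sub_le (X := X) (e := e) ⟨fun x => f x, _⟩ p q

theorem completionRestrict_surjective : Function.Surjective (completionRestrict X e) := by
  intro g
  have hg := g.lipBd.lipschitzWith
  have hext : ∀ x : X, Completion.extension g x = g x :=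
    fun x => Completion.extension_coe hg.uniformContinuous x
  exact ⟨⟨Completion.extension g, ⟨_, hg.completion_extension⟩, by rw [hext, g.apply_base]⟩,
    DFunLike.ext _ _ hext⟩

end Completion

end UniquePredual

theorem theorem3p2 (X : Type u) [MetricSpace X] (e : X)
    (hX : Bornology.IsBounded (Set.univ : Set X)) :
    UniquePredual.HasStronglyUniquePredual.{u, v} (UniquePredual.LipZero X e) := by
  obtain ⟨D, hD⟩ := Metric.isBounded_iff.1 hX
  have hD' : ∀ a b : UniformSpace.Completion X, dist a b ≤ D := fun a b => by
    induction a, b using UniformSpace.Completion.induction_on₂ with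
    | hp => exact isClosed_le continuous_dist continuous_const
    | ih p q =>
      rw [UniformSpace.Completion.dist_eq]
      exact hD (Set.mem_univ p) (Set.mem_univ q)
  -- Completing `X` keeps the bound on distances and, by unique extension of Lipschitz functions,
  -- the space `LipZero X e` up to isometry.
  exact UniquePredual.HasStronglyUniquePredual.congr
    (LinearIsometryEquiv.ofSurjective (UniquePredual.completionRestrict X e)
      (UniquePredual.completionRestrict_surjective X e)).symm
    (UniquePredual.hasStronglyUniquePredual_of_completeSpace _ _ hD')
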